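/- Let $r\ge 1$ and $\mathbb Z_q=\mathbb Z[q,q^{-1}]$, $q$ an indeterminate; algebras are associative unital $\mathbb Z_q$-algebras. Write $[x,y]_q=xy-q\,yx$. (a) Let $U_r$ be the algebra generated by $M_{\alpha,n}$ ($1\le\alpha\le r+2$, $n\in\mathbb Z$), with the convention $M_{0,n}=1$, subject to $$q^{\alpha}M_{\alpha,n+1}M_{\alpha,n-1}=M_{\alpha,n}^2-M_{\alpha+1,n}M_{\alpha-1,n}\qquad(1\le\alpha\le r+1,\ n\in\mathbb Z),$$ $$M_{\alpha,n}M_{\beta,n+\epsilon}=q^{\min(\alpha,\beta)\epsilon}M_{\beta,n+\epsilon}M_{\alpha,n}\qquad(1\le\alpha,\beta\le r+1,\ \epsilon\in\{0,1\},\ n\in\mathbb Z),$$ $$M_{r+2,n}=0\qquad(n\in\mathbb Z).$$ (b) Let $U_{\sqrt q}(\mathfrak n_+[u,u^{-1}])$ be the algebra generated by $M_n$, $n\in\mathbb Z$, subject to the exchange relation $(z-qw)\mathfrak m(z)\mathfrak m(w)+(w-qz)\mathfrak m(w)\mathfrak m(z)=0$ for $\mathfrak m(z)=\sum_n M_nz^n$.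 In components this means $$[M_{a-1},M_b]_q+[M_{b-1},M_a]_q=0\quad(a\neq b),\qquad [M_{a-1},M_a]_q=0,$$ the second family being the case $a=b$, in which the two $q$-commutators coincide. (c) In any algebra with a family $(M_n)_{n\in\mathbb Z}$ define the quantum determinants $$M_{\alpha,n}=\mathrm{CT}_{u_1,\dots,u_\alpha}\Big(\prod_{1\le a<b\le\alpha}\Big(1-q\frac{u_b}{u_a}\Big)\ \mathfrak m(u_1)\cdots\mathfrak m(u_\alpha)\,(u_1\cdots u_\alpha)^{-n}\Big),$$ where $\mathrm{CT}$ is the constant term in $u_1,\dots,u_\alpha$; thus $M_{0,n}=1$ and $M_{1,n}=M_n$. Let $E_r$ be the algebra generated by the $M_n$, $n\in\mathbb Z$, subject to the exchange relation and the rank condition $M_{r+2,n}=0$ for all $n$. For $A=U_r$, $E_r$, or a quotient as in (iii), let $A^{\rm loc}$ be the algebra obtained from $A$ by universally adjoining two-sided inverses of all $M_{\alpha,n}$, $1\le\alpha\le r+1$, $n\in\mathbb Z$. Then: (i) there is a surjective algebra homomorphism $\pi:U_r\to E_r$ sending $M_{\alpha,n}$ to the quantum determinant $M_{\alpha,n}$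 for $0\le\alpha\le r+2$ and all $n$; in particular $M_{1,n}\mapsto M_n$; (ii) $\pi$ induces an isomorphism $U_r^{\rm loc}\cong E_r^{\rm loc}$. That is, after the generators are made invertible, the algebra defined by the $M$-system, the commutation relations and the rank condition is isomorphic to the algebra generated by the $M_n$ subject only to the exchange relation and the rank condition, with the $M_{\alpha,n}$ given by the quantum determinants; (iii) $E_r$ is isomorphic, by $M_n\mapsto M_n$, to the quotient $Q_r$ of $U_{\sqrt q}(\mathfrak n_+[u,u^{-1}])$ by the two-sided ideal generated by all $M_{r+2,n}$, and correspondingly $U_r^{\rm loc}\cong Q_r^{\rm loc}$, compatibly with $\pi$. -/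

import Mathlib

open scoped LaurentPolynomial

noncomputable section

namespace QuantumQ

/-- The ground ring `ℤ[q, q⁻¹]`. -/
abbrev Zq : Type := ℤ[T;T⁻¹]

/-- The indeterminate `q` of the ground ring. -/
def q : Zq := LaurentPolynomial.T 1

/-! ### Adjoining two-sided inverses to a family of elements -/

/-- Relations on the free algebra on the elements of `A` together with symbols `t i`, `i : ι`:
the first three say that `A` maps in by an algebra homomorphism, the last two that `t i` is a
two-sided inverse of the image of `s i`. -/
inductive LocRel (R : Type) [CommRing R] {A ι : Type} [Ring A] [Algebra R A] (s : ι → A) :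
    FreeAlgebra R (A ⊕ ι) → FreeAlgebra R (A ⊕ ι) → Prop
  | add (x y : A) : LocRel R s
      (FreeAlgebra.ι R (Sum.inl x) + FreeAlgebra.ι R (Sum.inl y)) (FreeAlgebra.ι R (Sum.inl (x + y)))
  | mul (x y : A) : LocRel R s
      (FreeAlgebra.ι R (Sum.inl x) * FreeAlgebra.ι R (Sum.inl y)) (FreeAlgebra.ι R (Sum.inl (x * y)))
  | scalar (c : R) : LocRel R s
      (FreeAlgebra.ι R (Sum.inl (algebraMap R A c))) (algebraMap R (FreeAlgebra R (A ⊕ ι)) c)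
  | mul_inv (i : ι) : LocRel R s
      (FreeAlgebra.ι R (Sum.inl (s i)) * FreeAlgebra.ι R (Sum.inr i)) 1
  | inv_mul (i : ι) : LocRel R s
      (FreeAlgebra.ι R (Sum.inr i) * FreeAlgebra.ι R (Sum.inl (s i))) 1

/-- The (universal) localization of the `R`-algebra `A` obtained by adjoining inverses of the
elements `s i`. -/
abbrev Loc (R : Type) [CommRing R] {A ι : Type} [Ring A] [Algebra R A] (s : ι → A) : Type :=
  RingQuot (LocRel R s)

/-- The canonical homomorphism from an algebra to its localization. -/
def Loc.of (R : Type) [CommRing R] {A ι : Type} [Ring A] [Algebra R A] (s : ι → A) :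
    A →ₐ[R] Loc R s :=
  AlgHom.ofLinearMap
    { toFun := fun x => RingQuot.mkAlgHom R (LocRel R s) (FreeAlgebra.ι R (Sum.inl x))
      map_add' := fun x y => by
        rw [← RingQuot.mkAlgHom_rel R (LocRel.add (R := R) (s := s) x y), map_add]
      map_smul' := fun c x => by
        rw [Algebra.smul_def, ← RingQuot.mkAlgHom_rel R (LocRel.mul (R := R) (s := s) _ x), map_mul,
          RingQuot.mkAlgHom_rel R (LocRel.scalar (R := R) (s := s) c), AlgHom.commutes,
          ← Algebra.smul_def, RingHom.id_apply] }
    (by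
      have h := RingQuot.mkAlgHom_rel R (LocRel.scalar (R := R) (s := s) 1)
      simpa using h)
    (fun x y => by
      have h := RingQuot.mkAlgHom_rel R (LocRel.mul (R := R) (s := s) x y)
      rw [map_mul] at h
      exact h.symm)

/-! ### The algebra of the `M`-system -/

/-- The generator `M_{α,n}` of the free algebra on `{M_{α,n} : 1 ≤ α ≤ r + 2, n ∈ ℤ}`, with the
convention `M_{0,n} = 1` (values `α > r + 2` are never used). -/
def freeM (r α : ℕ) (n : ℤ) : FreeAlgebra Zq (Set.Icc 1 (r + 2) × ℤ) :=
  if h : α ∈ Set.Icc 1 (r + 2) then FreeAlgebra.ι Zq (⟨α, h⟩, n) else 1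

/-- The `M`-system, the commutation relations, and the rank condition. -/
inductive MRel (r : ℕ) : FreeAlgebra Zq (Set.Icc 1 (r + 2) × ℤ) →
    FreeAlgebra Zq (Set.Icc 1 (r + 2) × ℤ) → Prop
  | msys (α : ℕ) (n : ℤ) (h1 : 1 ≤ α) (h2 : α ≤ r + 1) : MRel r
      (q ^ α • (freeM r α (n + 1) * freeM r α (n - 1)))
      (freeM r α n ^ 2 - freeM r (α + 1) n * freeM r (α - 1) n)
  | comm (α β ε : ℕ) (n : ℤ) (hα1 : 1 ≤ α) (hα2 : α ≤ r + 1) (hβ1 : 1 ≤ β) (hβ2 : β ≤ r + 1)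
      (hε : ε ≤ 1) : MRel r
      (freeM r α n * freeM r β (n + ε))
      (q ^ (min α β * ε) • (freeM r β (n + ε) * freeM r α n))
  | rank (n : ℤ) : MRel r (freeM r (r + 2) n) 0

/-- The algebra generated by the `M_{α,n}` subject to the `M`-system, the commutation relations
and the rank condition. -/
abbrev MAlg (r : ℕ) : Type := RingQuot (MRel r)

/-- The element `M_{α,n}` of `MAlg r`. -/
def MAlg.M (r α : ℕ) (n : ℤ) : MAlg r := RingQuot.mkAlgHom Zq (MRel r) (freeM r α n)

/-! ### The quantum determinant -/

/-- The polynomial `∏_{a < b} (1 - q u_b / u_a)` in the Laurent polynomial ring in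
`u_1, …, u_α`, realized as the group algebra of the group `ℤ^α` of exponents. -/
def qVandermonde (α : ℕ) : AddMonoidAlgebra Zq (Fin α → ℤ) :=
  ∏ p : Fin α × Fin α with p.1 < p.2,
    (1 - AddMonoidAlgebra.single (Pi.single p.2 1 - Pi.single p.1 1) q)

/-- The constant term of `∏_{a<b} (1 - q u_b/u_a) · m(u_1) ⋯ m(u_α) · (u_1 ⋯ u_α)^{-n}`, where
`m(u) = ∑_k m_k u^k`: a monomial `c u^d` of the first factor contributes
`c m_{n - d_1} ⋯ m_{n - d_α}`. -/
def qDet {A : Type} [Ring A] [Algebra Zq A] (m : ℤ → A) (α : ℕ) (n : ℤ) : A :=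
  (qVandermonde α).coeff.sum fun d c => c • (List.ofFn fun i => m (n - d i)).prod

/-! ### The current algebra and its quotient -/

/-- The `q`-commutator `[x, y]_q = x y - q y x`. -/
def qComm {A : Type} [Ring A] [Algebra Zq A] (x y : A) : A := x * y - q • (y * x)

/-- The exchange relation `(z - q w) m(z) m(w) + (w - q z) m(w) m(z) = 0` in components. The
coefficient of `z^a w^b` is `[m_{a-1}, m_b]_q + [m_{b-1}, m_a]_q`. It is symmetric in `a, b`, and
for `a = b` it is twice `[m_{a-1}, m_a]_q`; there the relation imposed is `[m_{a-1}, m_a]_q = 0`. -/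
inductive ExchangeRel : FreeAlgebra Zq ℤ → FreeAlgebra Zq ℤ → Prop
  | offDiag (a b : ℤ) (h : a ≠ b) : ExchangeRel
      (qComm (FreeAlgebra.ι Zq (a - 1)) (FreeAlgebra.ι Zq b) +
        qComm (FreeAlgebra.ι Zq (b - 1)) (FreeAlgebra.ι Zq a)) 0
  | diag (a : ℤ) : ExchangeRel (qComm (FreeAlgebra.ι Zq (a - 1)) (FreeAlgebra.ι Zq a)) 0

/-- The exchange relation together with the rank condition `M_{r+2,n} = 0`, where `M_{r+2,n}` is
the quantum determinant. -/
inductive ExchangeRankRel (r : ℕ) : FreeAlgebra Zq ℤ → FreeAlgebra Zq ℤ → Prop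
  | exchange {x y : FreeAlgebra Zq ℤ} (h : ExchangeRel x y) : ExchangeRankRel r x y
  | rank (n : ℤ) : ExchangeRankRel r (qDet (FreeAlgebra.ι Zq) (r + 2) n) 0

/-- The algebra generated by the `M_n` subject to the exchange relation and the rank condition. -/
abbrev ExAlg (r : ℕ) : Type := RingQuot (ExchangeRankRel r)

/-- The generator `M_n` of `ExAlg r`. -/
def ExAlg.m (r : ℕ) (n : ℤ) : ExAlg r :=
  RingQuot.mkAlgHom Zq (ExchangeRankRel r) (FreeAlgebra.ι Zq n)

/-- The algebra `U_{√q}(𝔫₊[u, u⁻¹])` in its Drinfeld presentation: generators `e_n`, `n ∈ ℤ`,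
subject to `(z - q w) e(z) e(w) + (w - q z) e(w) e(z) = 0`. -/
abbrev CurAlg : Type := RingQuot ExchangeRel

/-- The Drinfeld generator `e_n`. -/
def CurAlg.e (n : ℤ) : CurAlg := RingQuot.mkAlgHom Zq ExchangeRel (FreeAlgebra.ι Zq n)

/-- The two-sided ideal of the current algebra generated by all `M_{r+2,n}`. -/
def rankIdeal (r : ℕ) : TwoSidedIdeal CurAlg :=
  TwoSidedIdeal.span (Set.range fun n : ℤ => qDet CurAlg.e (r + 2) n)

/-- The quotient of the current algebra by the ideal generated by all `M_{r+2,n}`. -/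
abbrev CurQuot (r : ℕ) : Type := (rankIdeal r).ringCon.Quotient

/-- The class of `e_n` in the quotient. -/
def CurQuot.e (r : ℕ) (n : ℤ) : CurQuot r := (CurAlg.e n : (rankIdeal r).ringCon.Quotient)

/-! ### The localizations -/

/-- The index set `{(α, n) : 1 ≤ α ≤ r + 1, n ∈ ℤ}`. -/
abbrev Idx (r : ℕ) : Type := Set.Icc 1 (r + 1) × ℤ

/-- The family `M_{α,n}`, `1 ≤ α ≤ r + 1`, in `MAlg r`. -/
def MAlg.fam (r : ℕ) (i : Idx r) : MAlg r := MAlg.M r i.1 i.2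

/-- The family `M_{α,n}`, `1 ≤ α ≤ r + 1`, of quantum determinants in `ExAlg r`. -/
def ExAlg.fam (r : ℕ) (i : Idx r) : ExAlg r := qDet (ExAlg.m r) i.1 i.2

/-- The family `M_{α,n}`, `1 ≤ α ≤ r + 1`, of quantum determinants in `CurQuot r`. -/
def CurQuot.fam (r : ℕ) (i : Idx r) : CurQuot r := qDet (CurQuot.e r) i.1 i.2

end QuantumQ

end

/-! The homomorphism from `MAlg r` to `ExAlg r` exists because the quantum determinants of any
family obeying the exchange relation solve the M-system and the commutation relations; it is onto
because its image contains the generators `M_n`. It is invertible after localization because, in a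
solution of the M-system with invertible entries, the row `M_{1,n}` obeys the exchange relation and
determines all other rows as quantum determinants. The two halves use unrelated ideas.

From the M-system to the exchange relation. Put `N = r + 1`. The ratios `M_{α+1,m} M_{α,m}⁻¹` obey a
noncommutative discrete evolution (`IsMSystem.isEvolution`). It carries monic polynomials `S_{α,m}`
of degree `α`, with noncommuting coefficients, which annihilate `α` consecutive moments of the
sequence `M_{1,n}` (`moment_S`). The rank condition makes `S_{N,m}` independent of `m` (`S_const`),
so it gives a linear recursion for `M_{1,n}`. For `α ≥ 1`, `S_{α,m}` also intertwines `X M_{1,m} - q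
M_{1,m+1}` with `X M_{1,m} - M_{1,m+1}` (`S_comm`). The moments of this identity are linear
relations, with leading coefficient 1, among the components of the exchange relation with one index
fixed. Induction on the distance of the two indices kills all components (`exch_add`). Once the
exchange relation holds, both `M_{α,n}` and the quantum determinants solve the same recursion in
`α`, and invertibility gives equality (`IsMSystem.eq_qDet`).

From the exchange relation to the M-system. It suffices to treat the current algebra, which acts on
functions of finite sets of variables by a shuffle product. There the quantum determinant `M_{α,n}`
becomes the `n`-th power of the product of `α` variables times a fixed symmetric factor (`qDet_T`).
The relations thereby become identities between sums over splittings of a set of variables into two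
parts, proved by the vanishing of residues (`splitSum_eq_zero`). They lift back because the action
is faithful (`realShuffle_injective`): decreasing words span the current algebra over `ℤ[q, q⁻¹]`,
and the functions representing them are linearly independent, as the growth in one variable tending
to infinity shows. -/

noncomputable section

namespace QuantumQ

open Polynomial

/-! ### Moment functionals on polynomials with noncommuting coefficients -/

section Moments

variable {A : Type*} [Ring A]

/-- The left linear functional `∑ p_i X^i ↦ ∑ p_i f (i + j)`. -/
def moment (f : ℤ → A) (j : ℤ) : A[X] →ₗ[A] A :=
  Polynomial.lsum fun i => LinearMap.toSpanSingleton A A (f (i + j))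

lemma moment_monomial (f : ℤ → A) (j : ℤ) (i : ℕ) (a : A) :
    moment f j (monomial i a) = a * f (i + j) := by
  simp [moment, Polynomial.lsum_apply, Polynomial.sum_monomial_index]

lemma moment_C_mul (f : ℤ → A) (j : ℤ) (a : A) (p : A[X]) :
    moment f j (C a * p) = a * moment f j p := by
  rw [← smul_eq_C_mul, map_smul, smul_eq_mul]

lemma moment_X_mul (f : ℤ → A) (j : ℤ) (p : A[X]) :
    moment f j (X * p) = moment f (j + 1) p := by
  induction p using Polynomial.induction_on' with
  | add p q hp hq => rw [mul_add, map_add, map_add, hp, hq]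
  | monomial n a =>
    rw [X_mul_monomial, moment_monomial, moment_monomial]
    congr 2
    push_cast
    ring

lemma moment_one (f : ℤ → A) (j : ℤ) : moment f j 1 = f j := by
  have := moment_monomial f j 0 1
  simpa using this

/-- This is the induction step for the exchange relation: a monic polynomial with vanishing moment
propagates the vanishing of `d` consecutive terms to the next one. -/
lemma eq_zero_of_moment_eq_zero {f : ℤ → A} {j : ℤ} {p : A[X]} {d : ℕ} (hp : p.natDegree ≤ d)
    (h1 : p.coeff d = 1) (hf : ∀ i : ℕ, i < d → f (i + j) = 0) (h : moment f j p = 0) :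
    f (d + j) = 0 := by
  have hs : p = ∑ i ∈ Finset.range (d + 1), monomial i (p.coeff i) :=
    p.as_sum_range' (d + 1) (by omega)
  rw [hs, map_sum, Finset.sum_range_succ, moment_monomial, h1, one_mul,
    Finset.sum_eq_zero, zero_add] at h
  · exact h
  · intro i hi
    rw [moment_monomial, hf i (Finset.mem_range.1 hi), mul_zero]

end Moments

/-! ### Orthogonal polynomials of the discrete evolution -/

/-- The discrete evolution of a family `b` with inverses `c (α + 1) m = (b α m)⁻¹`, of rank `N`. -/
structure IsEvolution {A : Type*} [Ring A] (N : ℕ) (b c : ℕ → ℤ → A) : Prop where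
  c_zero : ∀ m, c 0 m = 0
  b_top : ∀ m, b N m = 0
  c_mul_b : ∀ α m, α < N → c (α + 1) m * b α m = 1
  evol : ∀ α m, α < N →
    b α (m + 1) * (c (α + 1) m - c α m) = (b α m - b (α + 1) m) * c (α + 1) (m - 1)

namespace IsEvolution

variable {A : Type*} [Ring A]

/-- The coefficient of the recursion for the orthogonal polynomials. -/
def V (b c : ℕ → ℤ → A) (α : ℕ) (m : ℤ) : A := b α (m + 1) * (c (α + 1) m - c α m)

/-- The coefficient of the time evolution of the orthogonal polynomials. -/
def y (b c : ℕ → ℤ → A) (α : ℕ) (m : ℤ) : A := b α (m + 1) * c α m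

/-- The orthogonal polynomials. -/
def S (b c : ℕ → ℤ → A) : ℕ → ℤ → A[X]
  | 0, _ => 1
  | α + 1, m => X * S b c α m - C (V b c α m) * S b c α (m - 1)

variable {N : ℕ} {b c : ℕ → ℤ → A} (h : IsEvolution N b c)
include h

lemma V_eq {α : ℕ} (hα : α < N) (m : ℤ) :
    V b c α m = (b α m - b (α + 1) m) * c (α + 1) (m - 1) := h.evol α m hα

/-- Both `c (α + 1) m * b α m` and `c (α + 2) m * b (α + 1) m` equal 1, so one can be exchanged for
the other in the middle of the product. Together with `y_add_V` this is the compatibility of the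
recursion in `α` with the step in `m`. -/
lemma y_mul_V {α : ℕ} (hα : α + 1 < N) (m : ℤ) :
    y b c (α + 1) m * V b c α m = V b c (α + 1) m * y b c (α + 1) (m - 1) := by
  rw [h.V_eq (by omega), V, y, y, sub_add_cancel]
  have h1 := h.c_mul_b α m (by omega)
  have h2 := h.c_mul_b (α + 1) m (by omega)
  calc _ = b (α + 1) (m + 1) * (c (α + 1) m * b α m - c (α + 1) m * b (α + 1) m) *
        c (α + 1) (m - 1) := by noncomm_ring
    _ = b (α + 1) (m + 1) * (c (α + 1 + 1) m * b (α + 1) m - c (α + 1) m * b (α + 1) m) *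
        c (α + 1) (m - 1) := by rw [h1, h2]
    _ = _ := by noncomm_ring

lemma y_add_V {α : ℕ} (hα : α < N) (m : ℤ) :
    y b c (α + 1) m + V b c α (m + 1) = V b c α m + y b c α m := by
  rw [h.V_eq hα (m + 1), V, y, y, add_sub_cancel_right]
  noncomm_ring

omit h in
lemma S_succ (α : ℕ) (m : ℤ) :
    S b c (α + 1) m = X * S b c α m - C (V b c α m) * S b c α (m - 1) := rfl

/-- Removes the earlier time `m - 1` from the recursion. The time step enters as the hypothesis `ht`
because the lemma is also used inside the induction that proves `S_time`. -/
lemma V_mul_S {α : ℕ} (hα : α + 1 < N) (m : ℤ)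
    (ht : S b c (α + 1) m =
      S b c (α + 1) (m - 1) + C (y b c (α + 1) (m - 1)) * S b c α (m - 1)) :
    C (V b c (α + 1) m) * S b c (α + 1) (m - 1) = C (V b c (α + 1) m) * S b c (α + 1) m -
      C (y b c (α + 1) m) * (X * S b c α m - S b c (α + 1) m) := by
  have e3 : X * S b c α m - S b c (α + 1) m = C (V b c α m) * S b c α (m - 1) := by
    rw [S_succ, sub_sub_cancel]
  rw [e3, ← mul_assoc, ← C_mul, h.y_mul_V hα, C_mul, mul_assoc, ← mul_sub, ht, add_sub_cancel_right]

lemma S_time {α : ℕ} (hα : α + 1 ≤ N) (m : ℤ) :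
    S b c (α + 1) (m + 1) = S b c (α + 1) m + C (y b c (α + 1) m) * S b c α m := by
  induction α generalizing m with
  | zero =>
    have h1 := h.y_add_V (α := 0) (by omega) m
    have h0 : y b c 0 m = 0 := by rw [y, h.c_zero, mul_zero]
    rw [h0, add_zero] at h1
    simp only [S, ← h1, C_add]
    noncomm_ring
  | succ α ih =>
    have h1 : V b c (α + 1) (m + 1) = V b c (α + 1) m + y b c (α + 1) m - y b c (α + 2) m := by
      rw [← h.y_add_V (α := α + 1) (by omega) m]; abel
    have e2 := ih (by omega) (m - 1)
    rw [sub_add_cancel] at e2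
    rw [S_succ (α + 1), S_succ (α + 1), add_sub_cancel_right, h.V_mul_S (by omega) m e2,
      ih (by omega) m, h1, C_sub, C_add, mul_add X, ← mul_assoc X, X_mul_C, mul_assoc (C _) X]
    generalize X * S b c α m = P
    simp only [mul_sub, sub_mul, add_mul]
    abel

/-- A recursion with all polynomials at the same time `m`: the coefficients `V` and `y` add up to `b
(α + 1) (m + 1) * c (α + 2) m`. It is this form whose coefficients commute well with `M_{1,m}` and
`M_{1,m+1}`. -/
lemma S_three_term {α : ℕ} (hα : α + 1 < N) (m : ℤ) :
    S b c (α + 2) m = (X - C (b (α + 1) (m + 1) * c (α + 2) m)) * S b c (α + 1) m +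
      X * C (y b c (α + 1) m) * S b c α m := by
  have e2 := h.S_time (α := α) (by omega) (m - 1)
  rw [sub_add_cancel] at e2
  have hY : b (α + 1) (m + 1) * c (α + 2) m = V b c (α + 1) m + y b c (α + 1) m := by
    rw [V, y, mul_sub, sub_add_cancel]
  rw [S_succ (α + 1), h.V_mul_S hα m e2, hY, C_add, X_mul_C, mul_assoc (C _) X]
  generalize X * S b c α m = P
  simp only [mul_sub, sub_mul, add_mul]
  abel

/-- The coefficient of the time step at level `N` contains `b N = 0`, so the top polynomial is
conserved. -/
lemma S_const (m m' : ℤ) : S b c N m = S b c N m' := by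
  have key : ∀ m, S b c N (m + 1) = S b c N m := by
    intro m
    rcases Nat.eq_zero_or_pos N with h0 | h0
    · subst h0; rfl
    · obtain ⟨α, rfl⟩ : ∃ α, N = α + 1 := ⟨N - 1, by omega⟩
      rw [h.S_time le_rfl, y, h.b_top, zero_mul, C_0, zero_mul, add_zero]
  have h0 : ∀ m, S b c N m = S b c N 0 := by
    intro m
    induction m using Int.induction_on with
    | zero => rfl
    | succ i hi => rw [key, hi]
    | pred i hi => rw [← hi, ← key (-(i : ℤ) - 1), sub_add_cancel]
  rw [h0 m, h0 m']

omit h in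
lemma S_natDegree (α : ℕ) (m : ℤ) :
    (S b c α m).natDegree ≤ α ∧ (S b c α m).coeff α = 1 := by
  induction α generalizing m with
  | zero => simp [S]
  | succ α ih =>
    refine ⟨?_, ?_⟩
    · rw [S]
      refine (natDegree_sub_le _ _).trans (max_le ?_ ?_)
      · exact natDegree_mul_le.trans (by have := natDegree_X_le (R := A); have := (ih m).1; omega)
      · exact (natDegree_C_mul_le _ _).trans ((ih _).1.trans (by omega))
    · rw [S, coeff_sub, coeff_X_mul, (ih m).2, coeff_C_mul,
        coeff_eq_zero_of_natDegree_lt (lt_of_le_of_lt (ih (m - 1)).1 (by omega)), mul_zero, sub_zero]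

/-- The two claims support each other. In the recursion for `S (α + 1) m` all moments in the range
vanish term by term except the last, `j = m`, where the two terms cancel by the second claim at
level `α`. The second claim at level `α + 1` then follows from the time step and `y_mul_V`. -/
lemma moment_S {α : ℕ} (hα : α ≤ N) :
    (∀ m j : ℤ, m - α + 1 ≤ j → j ≤ m → moment (b 0) j (S b c α m) = 0) ∧
    (∀ m, α < N → V b c α m * moment (b 0) m (S b c α (m - 1)) =
      moment (b 0) (m + 1) (S b c α m)) := by
  induction α with
  | zero =>
    refine ⟨fun m j h1 h2 => by omega, fun m h0 => ?_⟩
    rw [S, S, moment_one, moment_one, V, h.c_zero, sub_zero, mul_assoc, h.c_mul_b _ _ h0, mul_one]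
  | succ α ih =>
    obtain ⟨ih1, ih2⟩ := ih (by omega)
    have key : ∀ m j : ℤ, m - (α + 1 : ℕ) + 1 ≤ j → j ≤ m →
        moment (b 0) j (S b c (α + 1) m) = 0 := by
      intro m j h1 h2
      rw [S, map_sub, moment_X_mul, moment_C_mul]
      push_cast at h1
      rcases h2.lt_or_eq with h2 | h2
      · rw [ih1 m (j + 1) (by omega) (by omega), ih1 (m - 1) j (by omega) (by omega), mul_zero,
          sub_zero]
      · rw [h2, ih2 m (by omega), sub_self]
    -- The moment `m + 1` of `S (α + 1) (m + 1)` vanishes; the time step expands it.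
    have top : ∀ m, moment (b 0) (m + 1) (S b c (α + 1) m) =
        - (y b c (α + 1) m * moment (b 0) (m + 1) (S b c α m)) := by
      intro m
      have := key (m + 1) (m + 1) (by push_cast; omega) le_rfl
      rw [h.S_time hα, map_add, moment_C_mul] at this
      exact eq_neg_of_add_eq_zero_left this
    refine ⟨key, fun m hm => ?_⟩
    have t2 := top (m - 1)
    rw [sub_add_cancel] at t2
    rw [top m, t2, mul_neg, ← mul_assoc, ← h.y_mul_V hm, mul_assoc, ih2 m (by omega)]

/-- The polynomial does not depend on `m`, so the window of vanishing moments can be moved anywhere: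
a linear recursion with fixed coefficients for `b 0`. -/
lemma moment_S_top (m j : ℤ) (hN : 0 < N) : moment (b 0) j (S b c N m) = 0 := by
  rw [h.S_const m j]
  exact (h.moment_S le_rfl).1 j j (by omega) le_rfl

end IsEvolution

end QuantumQ

end

noncomputable section

namespace QuantumQ

open Polynomial

/-- The indeterminate `q` as a unit of the ground ring. -/
def qU : Zqˣ :=
  ⟨LaurentPolynomial.T 1, LaurentPolynomial.T (-1), by rw [← LaurentPolynomial.T_add]; simp,
    by rw [← LaurentPolynomial.T_add]; simp⟩

lemma qU_val : (qU : Zq) = q := rfl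

/-! ### `q`-commuting pairs -/

section QC

variable {A : Type} [Ring A] [Algebra Zq A]

/-- `x` and `y` commute up to the factor `q ^ k`. -/
def QC (k : ℤ) (x y : A) : Prop := x * y = qU ^ k • (y * x)

namespace QC

variable {k l : ℤ} {x x' y z : A}

lemma symm (h : QC k x y) : QC (-k) y x := by
  rw [QC] at *
  rw [h, smul_smul, ← zpow_add, neg_add_cancel, zpow_zero, one_smul]

lemma mul_right (h : QC k x y) (h' : QC l x z) : QC (k + l) x (y * z) := by
  rw [QC] at *
  rw [← mul_assoc, h, smul_mul_assoc, mul_assoc, h', mul_smul_comm, smul_smul, ← zpow_add,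
    mul_assoc]

lemma inv_right (h : QC k x y) (h1 : y * z = 1) (h2 : z * y = 1) : QC (-k) x z := by
  rw [QC] at *
  have : z * x = qU ^ k • (x * z) := by
    calc z * x = z * (x * y) * z := by rw [mul_assoc, mul_assoc, h1, mul_one]
      _ = qU ^ k • (x * z) := by
        rw [h, mul_smul_comm, smul_mul_assoc, ← mul_assoc z, h2, one_mul]
  rw [this, smul_smul, ← zpow_add, neg_add_cancel, zpow_zero, one_smul]

lemma one_right : QC 0 x (1 : A) := by simp [QC]

lemma of_eq (h : QC k x y) (e : k = l) : QC l x y := e ▸ h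

lemma commute (h : QC 0 x y) : x * y = y * x := by simpa [QC] using h

end QC

end QC

/-! ### Solutions of the `M`-system -/

/-- A solution of the `M`-system of rank `N` satisfying the commutation relations. -/
structure IsMSystem {A : Type} [Ring A] [Algebra Zq A] (N : ℕ) (M : ℕ → ℤ → A) : Prop where
  zero : ∀ n, M 0 n = 1
  msys : ∀ α n, 1 ≤ α → α ≤ N →
    q ^ α • (M α (n + 1) * M α (n - 1)) = M α n ^ 2 - M (α + 1) n * M (α - 1) n
  comm : ∀ (α β ε : ℕ) (n : ℤ), 1 ≤ α → α ≤ N → 1 ≤ β → β ≤ N → ε ≤ 1 →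
    M α n * M β (n + ε) = q ^ (min α β * ε) • (M β (n + ε) * M α n)
  top : ∀ n, M (N + 1) n = 0

/-- `D` is the family of inverses of the elements `M α n`, `α ≤ N`. -/
def IsInverse {A : Type} [Ring A] (N : ℕ) (M D : ℕ → ℤ → A) : Prop :=
  ∀ α n, α ≤ N → M α n * D α n = 1 ∧ D α n * M α n = 1

namespace IsMSystem

variable {A : Type} [Ring A] [Algebra Zq A] {N : ℕ} {M D : ℕ → ℤ → A}

section

variable (h : IsMSystem N M)
include h

lemma comm_same {α β : ℕ} (n : ℤ) (hα : α ≤ N) (hβ : β ≤ N) : QC 0 (M α n) (M β n) := by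
  rcases Nat.eq_zero_or_pos α with rfl | hα0
  · rw [h.zero]; exact QC.one_right.symm
  rcases Nat.eq_zero_or_pos β with rfl | hβ0
  · rw [h.zero]; exact QC.one_right
  have := h.comm α β 0 n hα0 hα hβ0 hβ (by omega)
  simpa [QC] using this

lemma comm_next {α β : ℕ} (n : ℤ) (hα : α ≤ N) (hβ : β ≤ N) :
    QC (min α β : ℕ) (M α n) (M β (n + 1)) := by
  rcases Nat.eq_zero_or_pos α with rfl | hα0
  · rw [h.zero]; simpa using QC.one_right.symm
  rcases Nat.eq_zero_or_pos β with rfl | hβ0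
  · rw [h.zero]; simpa using QC.one_right
  have := h.comm α β 1 n hα0 hα hβ0 hβ le_rfl
  rw [QC, zpow_natCast, Units.smul_def, Units.val_pow_eq_pow_val, qU_val]
  simpa using this

end

/-- The ratios `M_{α+1,m} M_{α,m}⁻¹`. -/
def b (M D : ℕ → ℤ → A) (α : ℕ) (m : ℤ) : A := M (α + 1) m * D α m

/-- The inverse ratios. -/
def c (M D : ℕ → ℤ → A) : ℕ → ℤ → A
  -- The value 0 makes `y` vanish at level 0, the boundary condition of the evolution.
  | 0, _ => 0
  | α + 1, m => M α m * D (α + 1) m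

variable (h : IsMSystem N M) (hD : IsInverse N M D)
include h hD

lemma D_zero (n : ℤ) : D 0 n = 1 := by
  have := (hD 0 n (by omega)).1
  rwa [h.zero, one_mul] at this

omit h in
lemma comm_D {α β : ℕ} {n m : ℤ} {k : ℤ} (hβ : β ≤ N) (hc : QC k (M α n) (M β m)) :
    QC (-k) (M α n) (D β m) := hc.inv_right (hD β m hβ).1 (hD β m hβ).2

omit h in
lemma D_comm_D {α β : ℕ} {n m : ℤ} {k : ℤ} (hα : α ≤ N) (hβ : β ≤ N)
    (hc : QC k (M α n) (M β m)) : QC k (D α n) (D β m) :=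
  ((comm_D hD hβ hc).symm.inv_right (hD α n hα).1 (hD α n hα).2).symm.of_eq (by ring)

/-- The M-system at level `α + 1` brings the right side of the evolution to a product of four
factors; `evol_left` brings the other side to the same product through the M-system at level `α`, or
directly from `M_{0,n} = 1` if `α = 0`. -/
lemma evol_right {α : ℕ} (hα : α < N) (m : ℤ) :
    (b M D α m - b M D (α + 1) m) * c M D (α + 1) (m - 1) =
      M (α + 1) (m + 1) * (D α m * M α (m - 1) * D (α + 1) m) := by
  have hm : m - 1 + 1 = m := by ring
  have e1 : b M D α m - b M D (α + 1) m =
      (M (α + 1) m ^ 2 - M (α + 2) m * M α m) * (D (α + 1) m * D α m) := by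
    have k1 : M α m * D (α + 1) m = D (α + 1) m * M α m :=
      ((comm_D hD (by omega) (h.comm_same m (by omega) (by omega))).of_eq neg_zero).commute
    rw [b, b, sub_mul, pow_two, mul_assoc, ← mul_assoc (M (α + 1) m) (D (α + 1) m),
      (hD (α + 1) m (by omega)).1, one_mul, mul_assoc (M (α + 2) m), ← mul_assoc (M α m), k1,
      mul_assoc, (hD α m (by omega)).1, mul_one]
  have e2 := h.msys (α + 1) m (by omega) (by omega)
  rw [Nat.add_sub_cancel] at e2
  have c1 : QC (-(α + 1)) (M (α + 1) (m - 1)) (D (α + 1) m) := by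
    have := h.comm_next (α := α + 1) (β := α + 1) (m - 1) (by omega) (by omega)
    rw [hm] at this
    exact (comm_D hD (by omega) this).of_eq (by simp)
  have c2 : QC (-α) (M (α + 1) (m - 1)) (D α m) := by
    have := h.comm_next (α := α + 1) (β := α) (m - 1) (by omega) (by omega)
    rw [hm] at this
    exact (comm_D hD (by omega) this).of_eq (by simp)
  have c3 : QC 0 (M (α + 1) (m - 1)) (M α (m - 1)) := h.comm_same _ (by omega) (by omega)
  have c4 : QC (-α) (M α (m - 1)) (D (α + 1) m) := by
    have := h.comm_next (α := α) (β := α + 1) (m - 1) (by omega) (by omega)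
    rw [hm] at this
    exact (comm_D hD (by omega) this).of_eq (by simp)
  have c5 : QC 0 (D α m) (D (α + 1) m) :=
    D_comm_D hD (by omega) (by omega) (h.comm_same m (by omega) (by omega))
  -- Powers of `q`: the M-system supplies `α + 1`, moving `M_{α+1,m-1}` to the right costs `2α + 1`,
  -- and the resulting `-α` is exactly the cost of reordering the target product.
  have k := (c1.mul_right c2).mul_right c3
  have k' := (c5.symm.mul_right c4.symm).symm
  rw [QC] at k k'
  have e3 : q ^ (α + 1) • M (α + 1) (m - 1) = qU ^ ((α : ℤ) + 1) • M (α + 1) (m - 1) := by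
    rw [← Nat.cast_succ, zpow_natCast, Units.smul_def, Units.val_pow_eq_pow_val, qU_val]
  have e4 : M (α + 1) (m - 1) * (D (α + 1) m * D α m * M α (m - 1)) * D (α + 1) (m - 1) =
      qU ^ (-(α + 1) + -α + 0 : ℤ) • (D (α + 1) m * D α m * M α (m - 1)) := by
    rw [k, smul_mul_assoc, mul_assoc _ (M (α + 1) (m - 1)), (hD (α + 1) (m - 1) (by omega)).1,
      mul_one]
  calc _ = M (α + 1) (m + 1) * (q ^ (α + 1) • M (α + 1) (m - 1) *
        (D (α + 1) m * D α m * M α (m - 1)) * D (α + 1) (m - 1)) := by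
        rw [e1, ← e2, c, ← mul_smul_comm]
        simp only [mul_assoc]
    _ = _ := by
        rw [e3, smul_mul_assoc, smul_mul_assoc, e4, smul_smul, ← zpow_add, k', ← mul_assoc]
        congr 3
        ring

lemma evol_left {α : ℕ} (hα : α < N) (m : ℤ) :
    b M D α (m + 1) * (c M D (α + 1) m - c M D α m) =
      M (α + 1) (m + 1) * (D α m * M α (m - 1) * D (α + 1) m) := by
  cases α with
  | zero => simp [b, c, h.zero, h.D_zero hD]
  | succ α =>
    have e2 := h.msys (α + 1) m (by omega) (by omega)
    rw [Nat.add_sub_cancel] at e2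
    have k1 : M α m * D (α + 1) m = D (α + 1) m * M α m :=
      ((comm_D hD (by omega) (h.comm_same m (by omega) (by omega))).of_eq neg_zero).commute
    have k2 : M (α + 2) m * M α m = M α m * M (α + 2) m :=
      (h.comm_same m (by omega) (by omega)).commute
    have k3 : M (α + 2) m * D (α + 1) m = D (α + 1) m * M (α + 2) m :=
      ((comm_D hD (by omega) (h.comm_same m (by omega) (by omega))).of_eq neg_zero).commute
    have e1 : c M D (α + 2) m - c M D (α + 1) m =
        (M (α + 1) m ^ 2 - M (α + 2) m * M α m) * (D (α + 1) m * D (α + 2) m) := by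
      rw [c, c, sub_mul, pow_two, mul_assoc, ← mul_assoc (M (α + 1) m) (D (α + 1) m),
        (hD (α + 1) m (by omega)).1, one_mul, k2, mul_assoc, ← mul_assoc (M (α + 2) m), k3,
        mul_assoc (D (α + 1) m), (hD (α + 2) m (by omega)).1, mul_one]
    have c1 : QC (-(α + 1 : ℕ)) (M (α + 1) (m - 1)) (D (α + 1) m) := by
      have := h.comm_next (α := α + 1) (β := α + 1) (m - 1) (by omega) (by omega)
      rw [sub_add_cancel] at this
      exact (comm_D hD (by omega) this).of_eq (by simp)
    rw [QC] at c1
    have e3 : q ^ (α + 1) • M (α + 1) (m - 1) = qU ^ ((α + 1 : ℕ) : ℤ) • M (α + 1) (m - 1) := by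
      rw [zpow_natCast, Units.smul_def, Units.val_pow_eq_pow_val, qU_val]
    rw [e1, ← e2, b, ← mul_smul_comm, e3, mul_assoc (M (α + 1) (m + 1)),
      mul_assoc (M (α + 1 + 1) (m + 1)), ← mul_assoc (D (α + 1) (m + 1)),
      (hD (α + 1) (m + 1) (by omega)).2, one_mul, ← mul_assoc (_ • M (α + 1) (m - 1)),
      smul_mul_assoc, c1, smul_smul, ← zpow_add, add_neg_cancel, zpow_zero, one_smul]

lemma isEvolution : IsEvolution N (b M D) (c M D) where
  c_zero _ := rfl
  b_top m := by rw [b, h.top, zero_mul]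
  c_mul_b α m hα := by
    rw [b, c, mul_assoc, ← mul_assoc (D (α + 1) m), (hD (α + 1) m (by omega)).2, one_mul,
      (hD α m (by omega)).1]
  evol α m hα := by rw [h.evol_left hD hα, h.evol_right hD hα]

lemma b_zero (m : ℤ) : b M D 0 m = M 1 m := by rw [b, h.D_zero hD, mul_one]

/-! ### Commutation of the orthogonal polynomials with `M_{1,m}` -/

/-- For `α ≥ 1` the exponents `min 1 α` and `min 1 (α + 1)` are both 1, so they cancel in each
ratio. -/
lemma comm_Y {α : ℕ} (h0 : 1 ≤ α) (hα : α < N) (m : ℤ) :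
    QC 0 (M 1 m) (b M D α (m + 1) * c M D (α + 1) m) ∧
      QC 0 (M 1 (m + 1)) (b M D α (m + 1) * c M D (α + 1) m) := by
  have m1 : min 1 α = 1 := by omega
  have m2 : min 1 (α + 1) = 1 := by omega
  have m3 : min α 1 = 1 := by omega
  have m4 : min (α + 1) 1 = 1 := by omega
  have a1 := h.comm_next (α := 1) (β := α + 1) m (by omega) (by omega)
  have a2 := h.comm_next (α := 1) (β := α) m (by omega) (by omega)
  have a3 := h.comm_same (α := 1) (β := α) m (by omega) (by omega)
  have a4 := h.comm_same (α := 1) (β := α + 1) m (by omega) (by omega)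
  have b1 := h.comm_same (α := 1) (β := α + 1) (m + 1) (by omega) (by omega)
  have b2 := h.comm_same (α := 1) (β := α) (m + 1) (by omega) (by omega)
  have b3 := (h.comm_next (α := α) (β := 1) m (by omega) (by omega)).symm
  have b4 := (h.comm_next (α := α + 1) (β := 1) m (by omega) (by omega)).symm
  rw [m2] at a1
  rw [m1] at a2
  rw [m3] at b3
  rw [m4] at b4
  rw [b, c]
  refine ⟨(QC.mul_right (a1.mul_right (comm_D hD (by omega) a2))
    (a3.mul_right (comm_D hD (by omega) a4))).of_eq (by simp),
    (QC.mul_right (b1.mul_right (comm_D hD (by omega) b2))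
    (b3.mul_right (comm_D hD (by omega) b4))).of_eq (by simp)⟩

/-- The same cancellation, except that for `α = 0` the factor `M_{0,m} = 1` contributes no power of
`q`, which leaves one uncompensated `q`. -/
lemma comm_y {α : ℕ} (hα : α + 1 < N) (m : ℤ) :
    QC 0 (M 1 m) (IsEvolution.y (b M D) (c M D) (α + 1) m) ∧
      QC (if α = 0 then 1 else 0) (M 1 (m + 1)) (IsEvolution.y (b M D) (c M D) (α + 1) m) := by
  have m2 : min 1 (α + 2) = 1 := by omega
  have m1 : min 1 (α + 1) = 1 := by omega
  have m4 : min (α + 1) 1 = 1 := by omega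
  have a1 := h.comm_next (α := 1) (β := α + 2) m (by omega) (by omega)
  have a2 := h.comm_next (α := 1) (β := α + 1) m (by omega) (by omega)
  have a3 := h.comm_same (α := 1) (β := α) m (by omega) (by omega)
  have a4 := h.comm_same (α := 1) (β := α + 1) m (by omega) (by omega)
  have b1 := h.comm_same (α := 1) (β := α + 2) (m + 1) (by omega) (by omega)
  have b2 := h.comm_same (α := 1) (β := α + 1) (m + 1) (by omega) (by omega)
  have b3 := (h.comm_next (α := α) (β := 1) m (by omega) (by omega)).symm
  have b4 := (h.comm_next (α := α + 1) (β := 1) m (by omega) (by omega)).symm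
  rw [m2] at a1
  rw [m1] at a2
  rw [m4] at b4
  rw [IsEvolution.y, b, c]
  refine ⟨(QC.mul_right (a1.mul_right (comm_D hD (by omega) a2))
    (a3.mul_right (comm_D hD (by omega) a4))).of_eq (by simp),
    (QC.mul_right (b1.mul_right (comm_D hD (by omega) b2))
    (b3.mul_right (comm_D hD (by omega) b4))).of_eq ?_⟩
  rcases Nat.eq_zero_or_pos α with rfl | h0
  · simp
  · rw [if_neg (by omega), min_eq_right (by omega : 1 ≤ α)]; simp

/-- Degree one is a direct computation; higher degrees follow from `S_three_term`, whose
coefficients commute with the linear factor except at the bottom of the recursion. -/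
lemma S_comm (m : ℤ) {α : ℕ} (hα : α + 1 ≤ N) :
    (X * C (M 1 m) - C (M 1 (m + 1))) * IsEvolution.S (b M D) (c M D) (α + 1) m =
      IsEvolution.S (b M D) (c M D) (α + 1) m * (X * C (M 1 m) - C (q • M 1 (m + 1))) := by
  have hE := h.isEvolution hD
  have hMM : M 1 m * M 1 (m + 1) = q • (M 1 (m + 1) * M 1 m) := by
    have := h.comm_next (α := 1) (β := 1) m (by omega) (by omega)
    simpa [QC, Units.smul_def, qU_val] using this
  have comm_of : ∀ z : A, QC 0 (M 1 m) z → QC 0 (M 1 (m + 1)) z →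
      (X * C (M 1 m) - C (M 1 (m + 1))) * C z = C z * (X * C (M 1 m) - C (M 1 (m + 1))) := by
    intro z h1 h2
    rw [sub_mul, mul_sub, mul_assoc, ← C_mul, ← C_mul, h1.commute, h2.commute, C_mul, C_mul,
      ← mul_assoc, ← mul_assoc, X_mul_C]
  have hX : (X * C (M 1 m) - C (M 1 (m + 1))) * X = X * (X * C (M 1 m) - C (M 1 (m + 1))) :=
    X_mul.symm
  -- the case of degree one
  have base : (X * C (M 1 m) - C (M 1 (m + 1))) * IsEvolution.S (b M D) (c M D) 1 m =
      IsEvolution.S (b M D) (c M D) 1 m * (X * C (M 1 m) - C (q • M 1 (m + 1))) := by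
    have e : IsEvolution.V (b M D) (c M D) 0 m = M 1 (m + 1) * D 1 m := by
      rw [IsEvolution.V, b, c, c, h.D_zero hD, h.zero, sub_zero, one_mul, mul_one]
    have k1 : M 1 (m + 1) * D 1 m * M 1 m = M 1 (m + 1) := by
      rw [mul_assoc, (hD 1 m (by omega)).2, mul_one]
    have k2 : M 1 m * (M 1 (m + 1) * D 1 m) = q • M 1 (m + 1) := by
      rw [← mul_assoc, hMM, smul_mul_assoc, mul_assoc, (hD 1 m (by omega)).1, mul_one]
    have k3 : M 1 (m + 1) * (M 1 (m + 1) * D 1 m) = q • (M 1 (m + 1) * D 1 m * M 1 (m + 1)) := by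
      have : M 1 (m + 1) * D 1 m * (M 1 m * M 1 (m + 1)) = M 1 (m + 1) * M 1 (m + 1) := by
        rw [← mul_assoc, k1]
      rw [hMM, mul_smul_comm, ← mul_assoc] at this
      rw [← mul_assoc, ← this, smul_mul_assoc, mul_assoc _ (M 1 m), (hD 1 m (by omega)).1, mul_one]
    rw [IsEvolution.S_succ, e]
    have s0 : ∀ n, IsEvolution.S (b M D) (c M D) 0 n = 1 := fun _ => rfl
    rw [s0, s0, mul_one, mul_one]
    generalize M 1 (m + 1) * D 1 m = Y at *
    have g1 : X * C (M 1 m) * X = X * (X * C (M 1 m)) := by rw [mul_assoc, ← X_mul_C]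
    have g2 : C Y * (X * C (M 1 m)) = X * C (M 1 (m + 1)) := by
      rw [← mul_assoc, ← X_mul_C, mul_assoc, ← C_mul, k1]
    have g3 : X * C (M 1 m) * C Y = X * C (q • M 1 (m + 1)) := by rw [mul_assoc, ← C_mul, k2]
    rw [sub_mul, mul_sub, mul_sub, sub_mul, mul_sub, mul_sub, ← C_mul, ← C_mul, k3, g1, g2, g3,
      mul_smul_comm, ← X_mul_C]
  induction α using Nat.strong_induction_on with
  | _ α ih =>
    rcases Nat.eq_zero_or_pos α with rfl | h0
    · exact base
    obtain ⟨β, rfl⟩ : ∃ β, α = β + 1 := ⟨α - 1, by omega⟩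
    have i1 := ih β (by omega) (by omega)
    rw [hE.S_three_term (by omega) m]
    obtain ⟨y1, y2⟩ := h.comm_Y hD (α := β + 1) (by omega) (by omega) m
    obtain ⟨z1, z2⟩ := h.comm_y hD (α := β) (by omega) m
    have a1 : (X * C (M 1 m) - C (M 1 (m + 1))) *
        (X - C (b M D (β + 1) (m + 1) * c M D (β + 2) m)) =
        (X - C (b M D (β + 1) (m + 1) * c M D (β + 2) m)) *
          (X * C (M 1 m) - C (M 1 (m + 1))) := by
      rw [mul_sub, sub_mul (X : A[X]), comm_of _ y1 y2, hX]
    have a2 : (X * C (M 1 m) - C (M 1 (m + 1))) *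
        (X * C (IsEvolution.y (b M D) (c M D) (β + 1) m) * IsEvolution.S (b M D) (c M D) β m) =
        (X * C (IsEvolution.y (b M D) (c M D) (β + 1) m) * IsEvolution.S (b M D) (c M D) β m) *
          (X * C (M 1 m) - C (q • M 1 (m + 1))) := by
      -- `S 0 m = 1` does not satisfy the intertwining relation; the extra `q` of `comm_y` at `β =
      -- 0` makes up for it.
      rcases Nat.eq_zero_or_pos β with rfl | hβ
      · have s0 : IsEvolution.S (b M D) (c M D) 0 m = 1 := rfl
        have z1' := z1.commute
        have z2' : M 1 (m + 1) * IsEvolution.y (b M D) (c M D) 1 m =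
            q • (IsEvolution.y (b M D) (c M D) 1 m * M 1 (m + 1)) := by
          simpa [QC, Units.smul_def, qU_val] using z2
        simp only [zero_add] at *
        rw [s0, mul_one, ← mul_assoc, hX, mul_assoc, mul_assoc]
        congr 1
        rw [sub_mul, mul_sub, mul_assoc, ← C_mul, ← C_mul, z1', z2', C_mul, ← mul_assoc,
          ← mul_assoc, X_mul_C, ← C_mul, mul_smul_comm]
      · rw [if_neg (by omega)] at z2
        have i2 := ih (β - 1) (by omega) (by omega)
        rw [Nat.sub_add_cancel hβ] at i2
        rw [← mul_assoc, ← mul_assoc, hX, mul_assoc X, comm_of _ z1 z2, mul_assoc, mul_assoc, i2,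
          mul_assoc, mul_assoc]
    rw [mul_add, ← mul_assoc, a1, mul_assoc, i1, a2, add_mul, mul_assoc (X - _)]

end IsMSystem

end QuantumQ

end

noncomputable section

namespace QuantumQ

open Polynomial

/-! ### The exchange relation in the localized `M`-system -/

/-- The component `[f_{a-1}, f_b]_q + [f_{b-1}, f_a]_q` of the exchange relation. -/
def exch {A : Type} [Ring A] [Algebra Zq A] (f : ℤ → A) (a b : ℤ) : A :=
  qComm (f (a - 1)) (f b) + qComm (f (b - 1)) (f a)

lemma exch_symm {A : Type} [Ring A] [Algebra Zq A] (f : ℤ → A) (a b : ℤ) :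
    exch f a b = exch f b a := add_comm _ _

section

variable {A : Type} [Ring A] [Algebra Zq A]

/-- The values `f (m + 1)` and `f m` standing to the left of `f` must be inserted after the
coefficients of `p`, hence the products `p * C _`. -/
lemma moment_exch (f : ℤ → A) (m j : ℤ) (p : A[X]) :
    moment (fun a => exch f a (m + 1)) (j + 1) p =
      moment f j p * f (m + 1) - q • moment f j (p * C (f (m + 1))) +
        (moment f (j + 1) (p * C (f m)) - q • (moment f (j + 1) p * f m)) := by
  induction p using Polynomial.induction_on' with
  | add p r hp hr => rw [map_add, hp, hr]; simp only [add_mul, map_add, smul_add]; abel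
  | monomial i a =>
    simp only [monomial_mul_C, moment_monomial, exch, qComm]
    rw [show (i : ℤ) + (j + 1) - 1 = i + j by ring, show m + 1 - 1 = m by ring]
    simp only [mul_add, mul_sub, mul_smul_comm, mul_assoc]

end

namespace IsMSystem

variable {A : Type} [Ring A] [Algebra Zq A] {N : ℕ} {M D : ℕ → ℤ → A}
variable (h : IsMSystem N M) (hD : IsInverse N M D)
include h hD

/-- The moment `j` of `S_comm` is the claim: `h1` and `h2` kill its left side, and they also kill
the two terms of `moment_exch` in which the moment of `S` itself occurs. -/
lemma moment_exch_eq_zero (m j : ℤ) {α : ℕ} (hα : α + 1 ≤ N)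
    (h1 : moment (M 1) j (IsEvolution.S (b M D) (c M D) (α + 1) m) = 0)
    (h2 : moment (M 1) (j + 1) (IsEvolution.S (b M D) (c M D) (α + 1) m) = 0) :
    moment (fun a => exch (M 1) a (m + 1)) (j + 1)
      (IsEvolution.S (b M D) (c M D) (α + 1) m) = 0 := by
  have key := congrArg (moment (M 1) j) (h.S_comm hD m hα)
  rw [sub_mul, mul_sub, map_sub, map_sub, mul_assoc, moment_X_mul, moment_C_mul, moment_C_mul,
    h1, h2, mul_zero, mul_zero, sub_zero, ← mul_assoc, ← X_mul, mul_assoc, moment_X_mul] at key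
  have e : IsEvolution.S (b M D) (c M D) (α + 1) m * C (q • M 1 (m + 1)) =
      C (algebraMap Zq A q) * (IsEvolution.S (b M D) (c M D) (α + 1) m * C (M 1 (m + 1))) := by
    rw [Algebra.smul_def, C_mul, ← mul_assoc, ← mul_assoc]
    congr 1
    ext i
    rw [coeff_mul_C, coeff_C_mul, Algebra.commutes]
  rw [e, moment_C_mul, ← Algebra.smul_def] at key
  rw [moment_exch, h1, h2, zero_mul, zero_mul, smul_zero, sub_zero, zero_sub, neg_add_eq_sub]
  exact key.symm

/-- The M-system expresses `M_{2,a}` through `M_{1,n}`; its `q`-commutation with `M_{1,a-1}` then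
becomes the exchange component times `M_{1,a-1}`, which is cancelled. The bound `2 ≤ N` is what
allows `β = 2` in the commutation relation. -/
lemma exch_succ (hN : 2 ≤ N) (a : ℤ) : exch (M 1) (a + 1) a = 0 := by
  have e1 := h.comm 1 2 1 (a - 1) le_rfl (by omega) (by omega) hN le_rfl
  have e2 := h.comm 1 1 1 (a - 1) le_rfl (by omega) le_rfl (by omega) le_rfl
  have e3 := h.msys 1 a le_rfl (by omega)
  rw [Nat.sub_self, h.zero, mul_one, pow_one] at e3
  simp only [Nat.cast_one, sub_add_cancel, min_self, pow_one, mul_one] at e1 e2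
  rw [show min 1 2 = 1 from rfl, pow_one] at e1
  have e4 : M (1 + 1) a = M 1 a ^ 2 - q • (M 1 (a + 1) * M 1 (a - 1)) := by rw [e3]; abel
  change M 1 (a - 1) * M (1 + 1) a = _ at e1
  rw [show (2 : ℕ) = 1 + 1 from rfl, e4] at e1
  have e5 : M 1 (a - 1) * M 1 a ^ 2 = q • q • (M 1 a ^ 2 * M 1 (a - 1)) := by
    rw [pow_two, ← mul_assoc, e2, smul_mul_assoc, mul_assoc, e2, mul_smul_comm, mul_assoc]
  have e6 : q • (exch (M 1) (a + 1) a * M 1 (a - 1)) = 0 := by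
    rw [mul_sub, e5, sub_mul, smul_sub] at e1
    rw [exch, qComm, qComm, add_sub_cancel_right]
    rw [← sub_eq_zero] at e1
    rw [← neg_eq_zero, ← e1]
    simp only [add_mul, sub_mul, smul_add, smul_sub, smul_mul_assoc, mul_smul_comm, pow_two,
      mul_assoc]
    abel
  have e7 : exch (M 1) (a + 1) a * M 1 (a - 1) = 0 := by
    have := congrArg (fun x => (qU⁻¹ : Zqˣ) • x) e6
    simpa [Units.smul_def, ← qU_val, smul_smul] using this
  calc _ = exch (M 1) (a + 1) a * M 1 (a - 1) * D 1 (a - 1) := by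
        rw [mul_assoc, (hD 1 (a - 1) (by omega)).1, mul_one]
    _ = 0 := by rw [e7, zero_mul]

/-- Induction on the distance `d`; distances 0 and 1 come from the commutation relations and
`exch_succ`. For `d ≥ 2` a monic polynomial relates the component at distance `d` to components
already known to vanish. -/
lemma exch_add (hN : 2 ≤ N) (d : ℕ) (a : ℤ) : exch (M 1) (d + a) a = 0 := by
  induction d using Nat.strong_induction_on generalizing a with
  | _ d ih =>
    have hb : b M D 0 = M 1 := funext fun m => h.b_zero hD m
    rcases Nat.lt_or_ge d 2 with hd | hd
    · interval_cases d
      · have := h.comm 1 1 1 (a - 1) le_rfl (by omega) le_rfl (by omega) le_rfl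
        have h0 : qComm (M 1 (a - 1)) (M 1 a) = 0 := by
          rw [qComm, sub_eq_zero]
          simpa using this
        simp [exch, h0]
      · rw [Nat.cast_one, add_comm]
        exact h.exch_succ hD hN a
    · have hE := h.isEvolution hD
      -- The polynomial has degree `α + 1` and its first indices run from `a + d - α - 1` to `a +
      -- d`. With `α = d` they start at `a - 1`, and orthogonality supplies the two vanishing
      -- moments. If `d ≥ N` the conserved polynomial of degree `N` is used, and the indices start
      -- at `a + d - N ≥ a`.
      obtain ⟨α, hα1, hα2⟩ : ∃ α, α + 1 ≤ N ∧ (α = d ∨ (α + 1 = N ∧ N ≤ d)) ∧ 1 ≤ α := by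
        rcases Nat.lt_or_ge d N with hdN | hdN
        · exact ⟨d, by omega, by omega, by omega⟩
        · exact ⟨N - 1, by omega, by omega, by omega⟩
      have hj : ∀ j : ℤ, (j = a + d - α - 2 ∨ j = a + d - α - 1) →
          moment (M 1) j (IsEvolution.S (b M D) (c M D) (α + 1) (a - 1)) = 0 := by
        intro j hj
        rw [← hb]
        rcases hα2.1 with rfl | ⟨h1, h2⟩
        · exact (hE.moment_S hα1).1 _ _ (by push_cast; omega) (by omega)
        · have := hE.moment_S_top (a - 1) j (by omega)
          rwa [← h1] at this
      have key := h.moment_exch_eq_zero hD (a - 1) (a + d - α - 2) hα1 (hj _ (Or.inl rfl))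
        (hj _ (Or.inr (by ring)))
      rw [sub_add_cancel] at key
      have := eq_zero_of_moment_eq_zero (IsEvolution.S_natDegree (α + 1) (a - 1)).1
        (IsEvolution.S_natDegree (α + 1) (a - 1)).2 (fun i hi => ?_) key
      · rw [← this]
        congr 1
        push_cast
        ring
      -- The only index below `a` is `a - 1`, which occurs when `α = d` and `i = 0`; there symmetry
      -- reduces to distance 1.
      · rcases Nat.lt_or_ge (i + d) (α + 1) with hlt | hge
        · have e : (i : ℤ) + (a + d - α - 2 + 1) = a - 1 := by omega
          rw [e, exch_symm]
          have := ih 1 (by omega) (a - 1)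
          rwa [Nat.cast_one, add_sub_cancel] at this
        · have e : (i : ℤ) + (a + d - α - 2 + 1) = ((i + d - (α + 1) : ℕ) : ℤ) + a := by
            push_cast [hge]; ring
          rw [e]
          exact ih _ (by omega) a

/-- In a localization, the `M`-system implies the exchange relation. -/
theorem exch_eq_zero (hN : 2 ≤ N) (a a' : ℤ) : exch (M 1) a a' = 0 := by
  rcases le_total a' a with hle | hle
  · obtain ⟨d, rfl⟩ := Int.le.dest hle
    rw [add_comm]
    exact h.exch_add hD hN d a'
  · obtain ⟨d, rfl⟩ := Int.le.dest hle
    rw [add_comm, exch_symm]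
    exact h.exch_add hD hN d a

end IsMSystem

end QuantumQ

end

/-! ### From the exchange relation to the M-system: rational function identities and the shuffle
realization -/

noncomputable section

namespace QuantumQ

open Polynomial Finset

/-! ### Sums over splittings of a set of variables -/

section Splitting

variable {ι K : Type} [DecidableEq ι] [Field K] (x : ι → K) (u : K)

/-- The variables `x i` are nonzero, distinct, and stay so after multiplication by `u` or `u²`. -/
structure Generic : Prop where
  ne_zero : ∀ i, x i ≠ 0
  u_ne_zero : u ≠ 0
  inj : ∀ i j, x i = x j → i = j
  ne_u : ∀ i j, x i ≠ u * x j
  ne_u_sq : ∀ i j, x i ≠ u * (u * x j)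

/-- The interaction of a variable in the first part with a variable in the second part. -/
def om (i j : ι) : K := x i * x j / ((x i - x j) * (x j - u * x i))

/-- The interaction of two sets of variables. -/
def Om (I J : Finset ι) : K := ∏ i ∈ I, ∏ j ∈ J, om x u i j

/-- The sum over all splittings of `S` into two parts. -/
def splitSum (w : ℕ → K → K → K) (S : Finset ι) : K :=
  ∑ I ∈ S.powerset, w (#I) (∏ i ∈ I, x i) (∏ j ∈ S \ I, x j) * Om x u I (S \ I)

/-- The numerator of `om` when a variable `t` is in the first part. -/
def numL (t : K) (j : ι) : K := t * x j * (t - u * x j)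

/-- The numerator of `om` when a variable `t` is in the second part. -/
def numR (t : K) (i : ι) : K := -(x i * t * (x i - u * t))

/-- The common denominator of `om` for a variable `t`. -/
def den (t : K) (i : ι) : K := (t - x i) * (x i - u * t) * (t - u * x i)

/-- The numerator of the sum over splittings as a function of a distinguished variable `t`. -/
def splitNum (w : ℕ → K → K → K) (T : Finset ι) (t : K) : K :=
  ∑ I ∈ T.powerset, Om x u I (T \ I) *
    (w (#I + 1) (t * ∏ i ∈ I, x i) (∏ j ∈ T \ I, x j) *
        ((∏ j ∈ T \ I, numL x u t j) * ∏ i ∈ I, den x u t i) +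
      w (#I) (∏ i ∈ I, x i) (t * ∏ j ∈ T \ I, x j) *
        ((∏ i ∈ I, numR x u t i) * ∏ j ∈ T \ I, den x u t j))

variable {x u}

lemma Om_insert_left {l : ι} {I J : Finset ι} (hl : l ∉ I) :
    Om x u (insert l I) J = (∏ j ∈ J, om x u l j) * Om x u I J := by
  rw [Om, prod_insert hl, Om]

lemma Om_insert_right {l : ι} {I J : Finset ι} (hl : l ∉ J) :
    Om x u I (insert l J) = (∏ i ∈ I, om x u i l) * Om x u I J := by
  rw [Om, Om, ← prod_mul_distrib]
  exact prod_congr rfl fun i _ => prod_insert hl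

lemma sum_powerset_insert' {M : Type*} [AddCommMonoid M] {l : ι} {T : Finset ι} (hl : l ∉ T)
    (f : Finset ι → Finset ι → M) :
    ∑ I ∈ (insert l T).powerset, f I (insert l T \ I) =
      ∑ I ∈ T.powerset, (f I (insert l (T \ I)) + f (insert l I) (T \ I)) := by
  rw [sum_powerset_insert hl, ← sum_add_distrib]
  refine sum_congr rfl fun I hI => ?_
  have hlI : l ∉ I := fun h => hl (mem_powerset.1 hI h)
  rw [insert_sdiff_of_notMem _ hlI, insert_sdiff_insert, sdiff_insert_of_notMem hl]

variable (h : Generic x u)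
include h

omit [DecidableEq ι] in
-- `den` clears the poles of `om` in both orders of its arguments, so one common denominator serves
-- all splittings.
lemma om_mul_den {l j : ι} (hlj : l ≠ j) : om x u l j * den x u (x l) j = numL x u (x l) j := by
  have h1 : x l - x j ≠ 0 := sub_ne_zero.2 fun e => hlj (h.inj _ _ e)
  have h2 : x j - u * x l ≠ 0 := sub_ne_zero.2 (h.ne_u _ _)
  rw [om, den, numL, div_mul_eq_mul_div, div_eq_iff (mul_ne_zero h1 h2)]
  ring

omit [DecidableEq ι] in
lemma om_mul_den' {l i : ι} (hli : l ≠ i) : om x u i l * den x u (x l) i = numR x u (x l) i := by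
  have h1 : x i - x l ≠ 0 := sub_ne_zero.2 fun e => hli (h.inj _ _ e).symm
  have h2 : x l - u * x i ≠ 0 := sub_ne_zero.2 (h.ne_u _ _)
  rw [om, den, numR, div_mul_eq_mul_div, div_eq_iff (mul_ne_zero h1 h2)]
  ring

omit [DecidableEq ι] in
lemma om_mul_den_mul {l j : ι} (hlj : l ≠ j) :
    om x u l j * den x u (u * x l) j = numR x u (u * x l) j := by
  have h1 : x l - x j ≠ 0 := sub_ne_zero.2 fun e => hlj (h.inj _ _ e)
  have h2 : x j - u * x l ≠ 0 := sub_ne_zero.2 (h.ne_u _ _)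
  rw [om, den, numR, div_mul_eq_mul_div, div_eq_iff (mul_ne_zero h1 h2)]
  ring

omit [DecidableEq ι] in
lemma om_mul_den_div {l i : ι} (hli : l ≠ i) :
    om x u i l * den x u (x l / u) i = numL x u (x l / u) i := by
  have h1 : x i - x l ≠ 0 := sub_ne_zero.2 fun e => hli (h.inj _ _ e).symm
  have h2 : x l - u * x i ≠ 0 := sub_ne_zero.2 (h.ne_u _ _)
  have h3 := h.u_ne_zero
  rw [om, den, numL, div_mul_eq_mul_div, div_eq_iff (mul_ne_zero h1 h2)]
  field_simp

/-- Since `den (x l) l = 0`, only terms with `t` and `l` in different parts survive; exchanging `t`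
with `l` pairs them, and `numR = -numL` at this point makes each pair cancel. -/
lemma splitNum_self (w : ℕ → K → K → K) {T : Finset ι} {l : ι} (hl : l ∉ T) :
    splitNum x u w (insert l T) (x l) = 0 := by
  rw [splitNum, sum_powerset_insert' hl fun I J => Om x u I J *
    (w (#I + 1) (x l * ∏ i ∈ I, x i) (∏ j ∈ J, x j) *
        ((∏ j ∈ J, numL x u (x l) j) * ∏ i ∈ I, den x u (x l) i) +
      w (#I) (∏ i ∈ I, x i) (x l * ∏ j ∈ J, x j) *
        ((∏ i ∈ I, numR x u (x l) i) * ∏ j ∈ J, den x u (x l) j))]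
  refine sum_eq_zero fun I hI => ?_
  have hlI : l ∉ I := fun h => hl (mem_powerset.1 hI h)
  have hlJ : l ∉ T \ I := fun h => hl (mem_sdiff.1 h).1
  have d0 : den x u (x l) l = 0 := by simp [den]
  have e1 : (∏ i ∈ I, om x u i l) * ∏ i ∈ I, den x u (x l) i = ∏ i ∈ I, numR x u (x l) i := by
    rw [← prod_mul_distrib]
    exact prod_congr rfl fun i hi => om_mul_den' h fun e => hlI (e ▸ hi)
  have e2 : (∏ j ∈ T \ I, om x u l j) * ∏ j ∈ T \ I, den x u (x l) j =
      ∏ j ∈ T \ I, numL x u (x l) j := by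
    rw [← prod_mul_distrib]
    exact prod_congr rfl fun i hi => om_mul_den h fun e => hlJ (e ▸ hi)
  have e3 : numR x u (x l) l = - numL x u (x l) l := by simp only [numR, numL]
  simp only [Om_insert_left hlI, Om_insert_right hlJ, prod_insert hlI, prod_insert hlJ,
    card_insert_of_notMem hlI, d0]
  rw [← e1, ← e2, e3]
  ring

/-- At `t = u * x l` both `den` and `numL` vanish at `l`, so only terms with `l` in the first part
and `t` in the second survive. The factors involving `t` or `l` then become independent of the
splitting, leaving the sum `hres` over the remaining variables. `splitNum_div` is the mirror image.
-/
lemma splitNum_mul (w : ℕ → K → K → K) {T : Finset ι} {l : ι} (hl : l ∉ T)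
    (hres : splitSum x u (fun a X Y => w (a + 1) (x l * X) (u * x l * Y)) T = 0) :
    splitNum x u w (insert l T) (u * x l) = 0 := by
  have d0 : den x u (u * x l) l = 0 := by simp [den]
  have n0 : numL x u (u * x l) l = 0 := by simp [numL]
  rw [splitNum, sum_powerset_insert' hl fun I J => Om x u I J *
    (w (#I + 1) (u * x l * ∏ i ∈ I, x i) (∏ j ∈ J, x j) *
        ((∏ j ∈ J, numL x u (u * x l) j) * ∏ i ∈ I, den x u (u * x l) i) +
      w (#I) (∏ i ∈ I, x i) (u * x l * ∏ j ∈ J, x j) *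
        ((∏ i ∈ I, numR x u (u * x l) i) * ∏ j ∈ J, den x u (u * x l) j))]
  rw [← mul_zero (numR x u (u * x l) l * ∏ j ∈ T, numR x u (u * x l) j), ← hres, splitSum, mul_sum]
  refine sum_congr rfl fun I hI => ?_
  have hlI : l ∉ I := fun h => hl (mem_powerset.1 hI h)
  have hlJ : l ∉ T \ I := fun h => hl (mem_sdiff.1 h).1
  have e2 : (∏ j ∈ T \ I, om x u l j) * ∏ j ∈ T \ I, den x u (u * x l) j =
      ∏ j ∈ T \ I, numR x u (u * x l) j := by
    rw [← prod_mul_distrib]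
    exact prod_congr rfl fun i hi => om_mul_den_mul h fun e => hlJ (e ▸ hi)
  have e4 : ∏ j ∈ T, numR x u (u * x l) j =
      (∏ j ∈ T \ I, numR x u (u * x l) j) * ∏ i ∈ I, numR x u (u * x l) i :=
    (prod_sdiff (mem_powerset.1 hI)).symm
  simp only [Om_insert_left hlI, Om_insert_right hlJ, prod_insert hlI, prod_insert hlJ,
    card_insert_of_notMem hlI, d0, n0]
  rw [e4, ← e2]
  ring

lemma splitNum_div (w : ℕ → K → K → K) {T : Finset ι} {l : ι} (hl : l ∉ T)
    (hres : splitSum x u (fun a X Y => w (a + 1) (x l / u * X) (x l * Y)) T = 0) :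
    splitNum x u w (insert l T) (x l / u) = 0 := by
  have d0 : den x u (x l / u) l = 0 := by simp [den, mul_div_cancel₀ _ h.u_ne_zero]
  have n0 : numR x u (x l / u) l = 0 := by simp [numR, mul_div_cancel₀ _ h.u_ne_zero]
  rw [splitNum, sum_powerset_insert' hl fun I J => Om x u I J *
    (w (#I + 1) (x l / u * ∏ i ∈ I, x i) (∏ j ∈ J, x j) *
        ((∏ j ∈ J, numL x u (x l / u) j) * ∏ i ∈ I, den x u (x l / u) i) +
      w (#I) (∏ i ∈ I, x i) (x l / u * ∏ j ∈ J, x j) *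
        ((∏ i ∈ I, numR x u (x l / u) i) * ∏ j ∈ J, den x u (x l / u) j))]
  rw [← mul_zero (numL x u (x l / u) l * ∏ j ∈ T, numL x u (x l / u) j), ← hres, splitSum, mul_sum]
  refine sum_congr rfl fun I hI => ?_
  have hlI : l ∉ I := fun h => hl (mem_powerset.1 hI h)
  have hlJ : l ∉ T \ I := fun h => hl (mem_sdiff.1 h).1
  have e1 : (∏ i ∈ I, om x u i l) * ∏ i ∈ I, den x u (x l / u) i =
      ∏ i ∈ I, numL x u (x l / u) i := by
    rw [← prod_mul_distrib]
    exact prod_congr rfl fun i hi => om_mul_den_div h fun e => hlI (e ▸ hi)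
  have e4 : ∏ j ∈ T, numL x u (x l / u) j =
      (∏ j ∈ T \ I, numL x u (x l / u) j) * ∏ i ∈ I, numL x u (x l / u) i :=
    (prod_sdiff (mem_powerset.1 hI)).symm
  simp only [Om_insert_left hlI, Om_insert_right hlJ, prod_insert hlI, prod_insert hlJ,
    card_insert_of_notMem hlI, d0, n0]
  rw [e4, ← e1]
  ring

omit h in
-- Every `numL` and `numR` vanishes at 0. Only empty products escape, and these occur with the
-- weights `w 0` and `w (#T + 1)`.
lemma splitNum_zero (w : ℕ → K → K → K) (T : Finset ι) (hw0 : ∀ X Y, w 0 X Y = 0)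
    (hw1 : ∀ X Y, w (#T + 1) X Y = 0) : splitNum x u w T 0 = 0 := by
  refine sum_eq_zero fun I hI => ?_
  have n0 : ∀ i, numL x u 0 i = 0 := by simp [numL]
  have n1 : ∀ i, numR x u 0 i = 0 := by simp [numR]
  have e1 : w (#I + 1) (0 * ∏ i ∈ I, x i) (∏ j ∈ T \ I, x j) * ∏ j ∈ T \ I, numL x u 0 j = 0 := by
    rcases (T \ I).eq_empty_or_nonempty with e | ⟨j, hj⟩
    · rw [← (mem_powerset.1 hI).antisymm (sdiff_eq_empty_iff_subset.1 e)] at hw1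
      rw [hw1, zero_mul]
    · rw [prod_eq_zero hj (n0 j), mul_zero]
  have e2 : w (#I) (∏ i ∈ I, x i) (0 * ∏ j ∈ T \ I, x j) * ∏ i ∈ I, numR x u 0 i = 0 := by
    rcases I.eq_empty_or_nonempty with rfl | ⟨j, hj⟩
    · rw [card_empty, hw0, zero_mul]
    · rw [prod_eq_zero hj (n1 j), mul_zero]
  rw [← mul_assoc, e1, ← mul_assoc (w (#I) _ _), e2]
  ring

omit h in
-- Each `num` factor has degree at most 2 and each `den` factor at most 3; the weight may add one
-- degree for every `num` factor, which is the bound demanded by `hI` and `hJ`.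
lemma exists_splitNum_polynomial (w : ℕ → K → K → K) (T : Finset ι)
    (hI : ∀ a X Y, a ≤ #T → ∃ p : K[X], p.natDegree ≤ #T - a ∧ ∀ t, p.eval t = w (a + 1) (t * X) Y)
    (hJ : ∀ a X Y, ∃ p : K[X], p.natDegree ≤ a ∧ ∀ t, p.eval t = w a X (t * Y)) :
    ∃ g : K[X], g.natDegree ≤ 3 * #T ∧ ∀ t, g.eval t = splitNum x u w T t := by
  have hprod : ∀ (s : Finset ι) (n : ℕ) (f : ι → K[X]), (∀ i, (f i).natDegree ≤ n) →
      (∏ i ∈ s, f i).natDegree ≤ n * #s := fun s n f hf =>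
    (natDegree_prod_le _ _).trans ((sum_le_sum fun i _ => hf i).trans (by simp [mul_comm]))
  have hn : ∀ s : Finset ι, ∃ p : K[X], p.natDegree ≤ 2 * #s ∧
      ∀ t, p.eval t = ∏ j ∈ s, numL x u t j := by
    intro s
    refine ⟨∏ j ∈ s, (X * C (x j) * (X - C (u * x j))), ?_, fun t => ?_⟩
    · refine hprod _ _ _ fun i => ?_
      compute_degree
    · rw [eval_prod]; exact prod_congr rfl fun j _ => by simp [numL, mul_comm t]
  have hm : ∀ s : Finset ι, ∃ p : K[X], p.natDegree ≤ 2 * #s ∧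
      ∀ t, p.eval t = ∏ j ∈ s, numR x u t j := by
    intro s
    refine ⟨∏ j ∈ s, (-(C (x j) * X * (C (x j) - C u * X))), ?_, fun t => ?_⟩
    · refine hprod _ _ _ fun i => ?_
      compute_degree
    · rw [eval_prod]; exact prod_congr rfl fun j _ => by simp [numR]
  have hd : ∀ s : Finset ι, ∃ p : K[X], p.natDegree ≤ 3 * #s ∧
      ∀ t, p.eval t = ∏ j ∈ s, den x u t j := by
    intro s
    refine ⟨∏ j ∈ s, ((X - C (x j)) * (C (x j) - C u * X) * (X - C (u * x j))), ?_, fun t => ?_⟩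
    · refine hprod _ _ _ fun i => ?_
      compute_degree
    · rw [eval_prod]; exact prod_congr rfl fun j _ => by simp [den]
  have key : ∀ I : Finset ι, ∃ p : K[X], I ∈ T.powerset → p.natDegree ≤ 3 * #T ∧
      ∀ t, p.eval t = Om x u I (T \ I) *
    (w (#I + 1) (t * ∏ i ∈ I, x i) (∏ j ∈ T \ I, x j) *
        ((∏ j ∈ T \ I, numL x u t j) * ∏ i ∈ I, den x u t i) +
      w (#I) (∏ i ∈ I, x i) (t * ∏ j ∈ T \ I, x j) *
        ((∏ i ∈ I, numR x u t i) * ∏ j ∈ T \ I, den x u t j)) := by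
    intro I
    by_cases hIT : I ∈ T.powerset
    · have hc : #(T \ I) + #I = #T := card_sdiff_add_card_eq_card (mem_powerset.1 hIT)
      obtain ⟨p1, d1, f1⟩ := hI (#I) (∏ i ∈ I, x i) (∏ j ∈ T \ I, x j) (by omega)
      obtain ⟨p2, d2, f2⟩ := hJ (#I) (∏ i ∈ I, x i) (∏ j ∈ T \ I, x j)
      obtain ⟨p3, d3, f3⟩ := hn (T \ I)
      obtain ⟨p4, d4, f4⟩ := hd I
      obtain ⟨p5, d5, f5⟩ := hm I
      obtain ⟨p6, d6, f6⟩ := hd (T \ I)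
      refine ⟨C (Om x u I (T \ I)) * (p1 * (p3 * p4) + p2 * (p5 * p6)), fun _ => ⟨?_, fun t => ?_⟩⟩
      · refine (natDegree_C_mul_le _ _).trans ((natDegree_add_le _ _).trans (max_le ?_ ?_))
        · have := natDegree_mul_le (p := p1) (q := p3 * p4)
          have := natDegree_mul_le (p := p3) (q := p4)
          omega
        · have := natDegree_mul_le (p := p2) (q := p5 * p6)
          have := natDegree_mul_le (p := p5) (q := p6)
          omega
      · simp only [eval_mul, eval_add, eval_C, f1, f2, f3, f4, f5, f6]
    · exact ⟨0, fun hh => absurd hh hIT⟩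
  choose p hp using key
  refine ⟨∑ I ∈ T.powerset, p I, natDegree_sum_le_of_forall_le _ _ fun I hI' => (hp I hI').1,
    fun t => ?_⟩
  rw [eval_finsetSum]
  exact sum_congr rfl fun I hI' => (hp I hI').2 t

/-- A Liouville type criterion for the vanishing of a sum over splittings: all its residues
vanish and it is bounded. -/
theorem splitSum_eq_zero (w : ℕ → K → K → K) {T : Finset ι} {s : ι} (hs : s ∉ T)
    (hw0 : ∀ X Y, w 0 X Y = 0) (hw1 : ∀ X Y, w (#T + 1) X Y = 0)
    (hI : ∀ a X Y, a ≤ #T → ∃ p : K[X], p.natDegree ≤ #T - a ∧ ∀ t, p.eval t = w (a + 1) (t * X) Y)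
    (hJ : ∀ a X Y, ∃ p : K[X], p.natDegree ≤ a ∧ ∀ t, p.eval t = w a X (t * Y))
    (hr1 : ∀ l ∈ T,
      splitSum x u (fun a X Y => w (a + 1) (x l * X) (u * x l * Y)) (T.erase l) = 0)
    (hr2 : ∀ l ∈ T,
      splitSum x u (fun a X Y => w (a + 1) (x l / u * X) (x l * Y)) (T.erase l) = 0) :
    splitSum x u w (insert s T) = 0 := by
  classical
  obtain ⟨g, hg1, hg2⟩ := exists_splitNum_polynomial (x := x) (u := u) w T hI hJ
  have hu := h.u_ne_zero
  have i1 : Set.InjOn x T := fun i _ j _ e => h.inj _ _ e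
  have i2 : Set.InjOn (fun i => u * x i) T := fun i _ j _ e => h.inj _ _ (mul_left_cancel₀ hu e)
  have i3 : Set.InjOn (fun i => x i / u) T := fun i _ j _ e =>
    h.inj _ _ (by simpa [div_left_inj' hu] using e)
  have d1 : Disjoint (T.image fun i => u * x i) (T.image fun i => x i / u) := by
    rw [disjoint_left]
    intro a ha hb
    obtain ⟨i, -, rfl⟩ := mem_image.1 ha
    obtain ⟨j, -, e⟩ := mem_image.1 hb
    rw [div_eq_iff hu] at e
    exact h.ne_u_sq j i (by rw [e]; ring)
  have d2 : Disjoint (T.image x) (T.image (fun i => u * x i) ∪ T.image fun i => x i / u) := by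
    rw [disjoint_left]
    intro a ha hb
    obtain ⟨i, -, rfl⟩ := mem_image.1 ha
    rcases mem_union.1 hb with hb | hb
    · obtain ⟨j, -, e⟩ := mem_image.1 hb
      exact h.ne_u _ _ e.symm
    · obtain ⟨j, -, e⟩ := mem_image.1 hb
      rw [div_eq_iff hu] at e
      exact h.ne_u j i (by rw [e]; ring)
  have d0 : (0 : K) ∉ T.image x ∪ (T.image (fun i => u * x i) ∪ T.image fun i => x i / u) := by
    simp only [mem_union, mem_image, not_or, not_exists, not_and]
    exact ⟨fun i _ => h.ne_zero i, fun i _ => mul_ne_zero hu (h.ne_zero i),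
      fun i _ => div_ne_zero (h.ne_zero i) hu⟩
  -- The zeros are `0` and, for each `l` in `T`, the points `x l`, `u * x l`, `x l / u`: `3 * #T +
  -- 1` distinct points against degree at most `3 * #T`.
  have g0 : g = 0 := by
    refine eq_zero_of_natDegree_lt_card_of_eval_eq_zero' g
      (insert 0 (T.image x ∪ (T.image (fun i => u * x i) ∪ T.image fun i => x i / u))) ?_ ?_
    · intro a ha
      rw [hg2]
      rcases mem_insert.1 ha with rfl | ha
      · exact splitNum_zero w T hw0 hw1
      rcases mem_union.1 ha with ha | ha
      · obtain ⟨l, hl, rfl⟩ := mem_image.1 ha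
        have := splitNum_self h w (notMem_erase l T)
        rwa [insert_erase hl] at this
      rcases mem_union.1 ha with ha | ha
      · obtain ⟨l, hl, rfl⟩ := mem_image.1 ha
        have := splitNum_mul h w (notMem_erase l T) (hr1 l hl)
        rwa [insert_erase hl] at this
      · obtain ⟨l, hl, rfl⟩ := mem_image.1 ha
        have := splitNum_div h w (notMem_erase l T) (hr2 l hl)
        rwa [insert_erase hl] at this
    · rw [card_insert_of_notMem d0, card_union_of_disjoint d2, card_union_of_disjoint d1,
        card_image_of_injOn i1, card_image_of_injOn i2, card_image_of_injOn i3]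
      omega
  have hz : splitNum x u w T (x s) = 0 := by rw [← hg2, g0, eval_zero]
  have hne : ∏ j ∈ T, den x u (x s) j ≠ 0 := by
    refine prod_ne_zero_iff.2 fun j hj => ?_
    have hsj : s ≠ j := fun e => hs (e ▸ hj)
    exact mul_ne_zero (mul_ne_zero (sub_ne_zero.2 fun e => hsj (h.inj _ _ e))
      (sub_ne_zero.2 (h.ne_u _ _))) (sub_ne_zero.2 (h.ne_u _ _))
  have e : splitSum x u w (insert s T) * ∏ j ∈ T, den x u (x s) j = splitNum x u w T (x s) := by
    rw [splitSum, sum_powerset_insert' hs fun I J =>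
      w (#I) (∏ i ∈ I, x i) (∏ j ∈ J, x j) * Om x u I J, splitNum, sum_mul]
    refine sum_congr rfl fun I hI' => ?_
    have hlI : s ∉ I := fun h => hs (mem_powerset.1 hI' h)
    have hlJ : s ∉ T \ I := fun h => hs (mem_sdiff.1 h).1
    have e1 : (∏ i ∈ I, om x u i s) * ∏ i ∈ I, den x u (x s) i = ∏ i ∈ I, numR x u (x s) i := by
      rw [← prod_mul_distrib]
      exact prod_congr rfl fun i hi => om_mul_den' h fun e => hlI (e ▸ hi)
    have e2 : (∏ j ∈ T \ I, om x u s j) * ∏ j ∈ T \ I, den x u (x s) j =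
        ∏ j ∈ T \ I, numL x u (x s) j := by
      rw [← prod_mul_distrib]
      exact prod_congr rfl fun i hi => om_mul_den h fun e => hlJ (e ▸ hi)
    rw [← prod_sdiff (mem_powerset.1 hI'), Om_insert_left hlI, Om_insert_right hlJ,
      prod_insert hlI, prod_insert hlJ, card_insert_of_notMem hlI, ← e1, ← e2]
    ring
  rw [hz] at e
  exact (mul_eq_zero.1 e).resolve_right hne

end Splitting

end QuantumQ

end

noncomputable section

namespace QuantumQ

open Polynomial Finset

section Splitting

variable {ι K : Type} [DecidableEq ι] [Field K] {x : ι → K} {u : K}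

/-! ### Identities for sums over splittings -/

lemma splitSum_mul_left (r : K) (w : ℕ → K → K → K) (S : Finset ι) :
    splitSum x u (fun a X Y => r * w a X Y) S = r * splitSum x u w S := by
  simp only [splitSum, mul_sum, mul_assoc]

lemma splitSum_eq_zero_of_mul {w w' : ℕ → K → K → K} {S : Finset ι} (r : K)
    (hS : splitSum x u w S = 0) (hw : ∀ a X Y, w' a X Y = r * w a X Y) :
    splitSum x u w' S = 0 := by
  rw [show w' = fun a X Y => r * w a X Y from funext fun a => funext fun X => funext fun Y => hw a X Y,
    splitSum_mul_left, hS, mul_zero]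

lemma splitSum_sub (w w' : ℕ → K → K → K) (S : Finset ι) :
    splitSum x u (fun a X Y => w a X Y - w' a X Y) S = splitSum x u w S - splitSum x u w' S := by
  simp only [splitSum, sub_mul, sum_sub_distrib]

lemma splitSum_zero (f : K → K → K) (S : Finset ι) :
    splitSum x u (fun a X Y => if a = 0 then f X Y else 0) S = f 1 (∏ i ∈ S, x i) := by
  rw [splitSum, sum_eq_single ∅]
  · simp [Om]
  · intro I _ hI
    rw [if_neg (by simpa using hI), zero_mul]
  · simp

lemma splitSum_card (f : K → K → K) (S : Finset ι) {k : ℕ} (hk : #S = k) :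
    splitSum x u (fun a X Y => if a = k then f X Y else 0) S = f (∏ i ∈ S, x i) 1 := by
  rw [splitSum, sum_eq_single S]
  · simp [Om, hk]
  · intro I hI hIS
    rw [if_neg, zero_mul]
    intro e
    exact hIS (eq_of_subset_of_card_le (mem_powerset.1 hI) (by omega))
  · simp

variable (h : Generic x u)
include h

/-- Both residues are the same identity for `α - 1` and `β - 1`. If `α` or `β` is 0, only the two
trivial splittings contribute. -/
lemma splitSum_same (α β : ℕ) (S : Finset ι) (hS : #S = α + β) :
    splitSum x u (fun a _ _ => (if a = α then 1 else 0) - (if a = β then 1 else 0)) S = 0 := by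
  induction α generalizing β S with
  | zero =>
    rw [splitSum_sub, splitSum_zero (fun _ _ => 1), splitSum_card (fun _ _ => 1) S (by omega),
      sub_self]
  | succ α ih =>
    cases β with
    | zero =>
      rw [splitSum_sub, splitSum_zero (fun _ _ => 1), splitSum_card (fun _ _ => 1) S (by omega),
        sub_self]
    | succ β =>
      obtain ⟨s, hs⟩ : S.Nonempty := card_pos.1 (by omega)
      have hT : #(S.erase s) + 1 = #S := card_erase_add_one hs
      have hr : ∀ l ∈ S.erase s, splitSum x u (fun a _ _ => (if a + 1 = α + 1 then (1 : K) else 0) -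
          (if a + 1 = β + 1 then 1 else 0)) ((S.erase s).erase l) = 0 := by
        intro l hl
        have := card_erase_add_one hl
        simp only [Nat.add_right_cancel_iff]
        exact ih β _ (by omega)
      rw [← insert_erase hs]
      refine splitSum_eq_zero h _ (notMem_erase s S) ?_ ?_ ?_ ?_ hr hr
      · intro X Y; simp
      · intro X Y; rw [if_neg (by omega), if_neg (by omega), sub_self]
      · exact fun a X Y _ => ⟨C _, (natDegree_C _).trans_le (Nat.zero_le _), fun t => eval_C⟩
      · exact fun a X Y => ⟨C _, (natDegree_C _).trans_le (Nat.zero_le _), fun t => eval_C⟩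

/-- The residues reproduce the identity with both parameters lowered by one, up to a scalar; the
shift of `min` by one is absorbed by the additional factor `u`. -/
lemma splitSum_next (α β : ℕ) (S : Finset ι) (hS : #S = α + β) :
    splitSum x u (fun a X Y => (if a = α then Y else 0) -
      u ^ min α β * (if a = β then X else 0)) S = 0 := by
  induction α generalizing β S with
  | zero =>
    rw [splitSum_sub, splitSum_mul_left, splitSum_zero (fun _ Y => Y),
      splitSum_card (fun X _ => X) S (by omega)]
    simp
  | succ α ih =>
    cases β with
    | zero =>
      rw [splitSum_sub, splitSum_mul_left, splitSum_zero (fun X _ => X),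
        splitSum_card (fun _ Y => Y) S (by omega)]
      simp
    | succ β =>
      have hu := h.u_ne_zero
      obtain ⟨s, hs⟩ : S.Nonempty := card_pos.1 (by omega)
      have hT : #(S.erase s) + 1 = #S := card_erase_add_one hs
      rw [← insert_erase hs]
      refine splitSum_eq_zero h _ (notMem_erase s S) ?_ ?_ ?_ ?_ ?_ ?_
      · intro X Y; simp
      · intro X Y; rw [if_neg (by omega), if_neg (by omega)]; simp
      · intro a X Y ha
        rcases eq_or_ne a β with rfl | hne
        · refine ⟨C (if a + 1 = α + 1 then Y else 0) - C (u ^ min (α + 1) (a + 1) * X) *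
            Polynomial.X, ?_, fun t => ?_⟩
          · refine le_trans ?_ (by omega : 1 ≤ _)
            compute_degree
          · simp; ring
        · refine ⟨C (if a + 1 = α + 1 then Y else 0), by simp, fun t => ?_⟩
          rw [if_neg (by omega : ¬ a + 1 = β + 1)]; simp
      · intro a X Y
        rcases eq_or_ne a (α + 1) with rfl | hne
        · refine ⟨Polynomial.X * C Y - C (u ^ min (α + 1) (β + 1) *
            (if α + 1 = β + 1 then X else 0)), ?_, fun t => ?_⟩
          · refine le_trans ?_ (by omega : 1 ≤ _)
            compute_degree
          · simp [mul_comm t]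
        · refine ⟨C (- (u ^ min (α + 1) (β + 1) * (if a = β + 1 then X else 0))), by simp,
            fun t => ?_⟩
          rw [if_neg hne]; simp
      · intro l hl
        have hc := card_erase_add_one hl
        have := ih β ((S.erase s).erase l) (by omega)
        refine splitSum_eq_zero_of_mul (u * x l) this fun a X Y => ?_
        simp only [Nat.add_right_cancel_iff, Nat.add_min_add_right, pow_succ]
        split_ifs <;> ring
      · intro l hl
        have hc := card_erase_add_one hl
        have := ih β ((S.erase s).erase l) (by omega)
        refine splitSum_eq_zero_of_mul (x l) this fun a X Y => ?_
        simp only [Nat.add_right_cancel_iff, Nat.add_min_add_right, pow_succ]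
        split_ifs <;> field_simp <;> ring

/-- Residues lower `α` by one. The base case is an explicit computation in two variables: there the
weight of the full set does not vanish, so the residue criterion does not apply. -/
lemma splitSum_msys (α : ℕ) (S : Finset ι) (hS : #S = 2 * (α + 1)) :
    splitSum x u (fun a X Y => u ^ (α + 1) * (if a = α + 1 then X ^ 2 else 0) -
      ((if a = α + 1 then X * Y else 0) - (if a = α + 2 then X * Y else 0))) S = 0 := by
  have hu := h.u_ne_zero
  induction α generalizing S with
  | zero =>
    obtain ⟨i, j, hij, rfl⟩ := card_eq_two.1 hS
    have hji : j ≠ i := hij.symm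
    have h1 : x i - x j ≠ 0 := sub_ne_zero.2 fun e => hij (h.inj _ _ e)
    have h2 : x j - x i ≠ 0 := sub_ne_zero.2 fun e => hji (h.inj _ _ e)
    have h3 : x j - u * x i ≠ 0 := sub_ne_zero.2 (h.ne_u _ _)
    have h4 : x i - u * x j ≠ 0 := sub_ne_zero.2 (h.ne_u _ _)
    have e : ∀ f : Finset ι → Finset ι → K, ∑ I ∈ ({i, j} : Finset ι).powerset, f I ({i, j} \ I) =
        f ∅ {i, j} + f {i} {j} + (f {j} {i} + f {i, j} ∅) := by
      intro f
      have := sum_powerset_insert' (by simpa using hij : i ∉ ({j} : Finset ι)) f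
      rw [this, show ({j} : Finset ι).powerset = {∅, {j}} by ext; simp [subset_singleton_iff],
        sum_pair (by simp)]
      simp
    rw [splitSum, e fun I J => (u ^ (0 + 1) * (if #I = 0 + 1 then (∏ i ∈ I, x i) ^ 2 else 0) -
      ((if #I = 0 + 1 then (∏ i ∈ I, x i) * ∏ j ∈ J, x j else 0) -
        (if #I = 0 + 2 then (∏ i ∈ I, x i) * ∏ j ∈ J, x j else 0))) * Om x u I J]
    simp only [card_empty, card_singleton, card_pair hij, prod_singleton, prod_pair hij, prod_empty,
      Om, om]
    norm_num
    field_simp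
    ring
  | succ α ih =>
    obtain ⟨s, hs⟩ : S.Nonempty := card_pos.1 (by omega)
    have hT : #(S.erase s) + 1 = #S := card_erase_add_one hs
    rw [← insert_erase hs]
    refine splitSum_eq_zero h _ (notMem_erase s S) ?_ ?_ ?_ ?_ ?_ ?_
    · intro X Y; simp
    · intro X Y; rw [if_neg (by omega), if_neg (by omega), if_neg (by omega)]; simp
    · intro a X Y ha
      by_cases h1 : a = α + 1
      · subst h1
        refine ⟨C (u ^ (α + 1 + 1) * X ^ 2) * Polynomial.X ^ 2 - C (X * Y) * Polynomial.X, ?_,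
          fun t => ?_⟩
        · refine le_trans ?_ (by omega : 2 ≤ _)
          compute_degree
        · simp; ring
      by_cases h2 : a = α + 2
      · subst h2
        refine ⟨C (X * Y) * Polynomial.X, ?_, fun t => ?_⟩
        · refine le_trans ?_ (by omega : 1 ≤ _)
          compute_degree
        · simp; ring
      · refine ⟨0, by simp, fun t => ?_⟩
        rw [if_neg (by omega), if_neg (by omega), if_neg (by omega)]; simp
    · intro a X Y
      rcases Nat.eq_zero_or_pos a with rfl | ha
      · exact ⟨0, by simp, fun t => by simp⟩
      refine ⟨C (u ^ (α + 1 + 1) * (if a = α + 1 + 1 then X ^ 2 else 0)) - Polynomial.X *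
        C ((if a = α + 1 + 1 then X * Y else 0) - (if a = α + 1 + 2 then X * Y else 0)), ?_,
        fun t => ?_⟩
      · refine le_trans ?_ (by omega : 1 ≤ _)
        compute_degree
      · simp only [eval_sub, eval_mul, eval_C, eval_X]
        split_ifs <;> ring
    · intro l hl
      have hc := card_erase_add_one hl
      have := ih ((S.erase s).erase l) (by omega)
      refine splitSum_eq_zero_of_mul (u * x l ^ 2) this fun a X Y => ?_
      have e2 : a + 1 = α + 1 + 2 ↔ a = α + 2 := by omega
      simp only [Nat.add_right_cancel_iff, e2, pow_succ u (α + 1)]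
      split_ifs <;> ring
    · intro l hl
      have hc := card_erase_add_one hl
      have := ih ((S.erase s).erase l) (by omega)
      refine splitSum_eq_zero_of_mul (x l ^ 2 / u) this fun a X Y => ?_
      have e2 : a + 1 = α + 1 + 2 ↔ a = α + 2 := by omega
      simp only [Nat.add_right_cancel_iff, e2, pow_succ u (α + 1)]
      split_ifs <;> field_simp <;> ring

end Splitting

end QuantumQ

end

noncomputable section

namespace QuantumQ

open Finset

/-! ### The shuffle product -/

section Shuffle

variable {ι K : Type} [DecidableEq ι] [Field K] (x : ι → K) (u : K)

/-- The kernel of the shuffle product. -/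
def Zk (I J : Finset ι) : K := ∏ i ∈ I, ∏ j ∈ J, (x i - u * x j) / (x i - x j)

/-- The shuffle product of functions of finite sets of variables. -/
def star (g f : Finset ι → K) (S : Finset ι) : K :=
  ∑ I ∈ S.powerset, g I * f (S \ I) * Zk x u I (S \ I)

/-- The self-interaction of a set of variables. -/
def PP (S : Finset ι) : K := ∏ p ∈ S.offDiag, (x p.1 - u * x p.2) / x p.1

/-- The function representing the quantum determinant `M_{α,n}`. -/
def gg (α : ℕ) (n : ℤ) (S : Finset ι) : K := if #S = α then (∏ i ∈ S, x i) ^ n * PP x u S else 0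

variable {x u}

lemma Zk_union_left {I I' J : Finset ι} (h : Disjoint I I') :
    Zk x u (I ∪ I') J = Zk x u I J * Zk x u I' J := prod_union h

lemma Zk_union_right {I J J' : Finset ι} (h : Disjoint J J') :
    Zk x u I (J ∪ J') = Zk x u I J * Zk x u I J' := by
  rw [Zk, Zk, Zk, ← prod_mul_distrib]
  exact prod_congr rfl fun i _ => prod_union h

/-- Both sides are sums over ordered splittings into three parts, and the kernel is multiplicative
in each argument. -/
lemma star_assoc (g f k : Finset ι → K) : star x u (star x u g f) k = star x u g (star x u f k) := by
  funext S
  simp only [star, sum_mul, mul_sum]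
  rw [sum_sigma', sum_sigma']
  refine sum_nbij' (fun p => ⟨p.2, p.1 \ p.2⟩) (fun p => ⟨p.1 ∪ p.2, p.1⟩) ?_ ?_ ?_ ?_ ?_
  · rintro ⟨U, I⟩ hp
    simp only [mem_sigma, mem_powerset] at hp ⊢
    exact ⟨hp.2.trans hp.1, sdiff_subset_sdiff hp.1 le_rfl⟩
  · rintro ⟨I, I'⟩ hp
    simp only [mem_sigma, mem_powerset] at hp ⊢
    exact ⟨union_subset hp.1 (hp.2.trans sdiff_subset), subset_union_left⟩
  · rintro ⟨U, I⟩ hp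
    simp only [mem_sigma, mem_powerset] at hp ⊢
    rw [union_sdiff_of_subset hp.2]
  · rintro ⟨I, I'⟩ hp
    simp only [mem_sigma, mem_powerset] at hp ⊢
    rw [union_sdiff_cancel_left (disjoint_of_subset_right hp.2 disjoint_sdiff)]
  · rintro ⟨U, I⟩ hp
    simp only [mem_sigma, mem_powerset] at hp ⊢
    obtain ⟨hU, hI⟩ := hp
    have e1 : (S \ I) \ (U \ I) = S \ U := by
      ext a; simp only [mem_sdiff]
      constructor
      · rintro ⟨⟨h1, h2⟩, h3⟩; exact ⟨h1, fun h => h3 ⟨h, h2⟩⟩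
      · rintro ⟨h1, h2⟩; exact ⟨⟨h1, fun h => h2 (hI h)⟩, fun h => h2 h.1⟩
    have e2 : S \ I = (U \ I) ∪ (S \ U) := by
      rw [← e1, union_sdiff_of_subset (sdiff_subset_sdiff hU le_rfl)]
    have d1 : Disjoint (U \ I) (S \ U) := disjoint_sdiff.mono_left sdiff_subset
    have e3 : Zk x u U (S \ U) = Zk x u I (S \ U) * Zk x u (U \ I) (S \ U) := by
      rw [← Zk_union_left disjoint_sdiff, union_sdiff_of_subset hI]
    have e4 : Zk x u I (S \ I) = Zk x u I (U \ I) * Zk x u I (S \ U) := by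
      rw [e2, Zk_union_right d1]
    rw [e1, e3, e4]
    ring

lemma star_one (a : ℤ) (f : Finset ι → K) (S : Finset ι) :
    star x u (gg x u 1 a) f S = ∑ i ∈ S, x i ^ a * Zk x u {i} (S.erase i) * f (S.erase i) := by
  rw [star]
  symm
  refine sum_of_injOn (fun i => {i}) (by simp) ?_ ?_ ?_
  · intro i hi
    simpa using hi
  · intro I hI hI'
    rw [gg, if_neg, zero_mul, zero_mul]
    intro h1
    obtain ⟨i, rfl⟩ := card_eq_one.1 h1
    exact hI' ⟨i, by simpa using hI, rfl⟩
  · intro i hi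
    simp [gg, PP, sdiff_singleton_eq_erase]
    ring

variable (x u) in
/-- Left multiplication in the shuffle product. -/
def T (g : Finset ι → K) : Module.End K (Finset ι → K) where
  toFun f := star x u g f
  map_add' f k := by
    funext S
    simp only [star, Pi.add_apply, ← sum_add_distrib]
    exact sum_congr rfl fun I _ => by ring
  map_smul' r f := by
    funext S
    simp only [star, Pi.smul_apply, smul_eq_mul, mul_sum, RingHom.id_apply]
    exact sum_congr rfl fun I _ => by ring

lemma T_apply (g f : Finset ι → K) : T x u g f = star x u g f := rfl

lemma T_mul (g f : Finset ι → K) : T x u g * T x u f = T x u (star x u g f) := by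
  ext1 k
  exact (star_assoc g f k).symm

variable (x u) in
/-- `T` as a linear map. -/
def Tl : (Finset ι → K) →ₗ[K] Module.End K (Finset ι → K) where
  toFun := T x u
  map_add' g k := by
    ext f S
    simp only [T_apply, star, Pi.add_apply, LinearMap.add_apply, ← sum_add_distrib]
    exact sum_congr rfl fun I _ => by ring
  map_smul' r g := by
    ext f S
    simp only [T_apply, star, Pi.smul_apply, smul_eq_mul, mul_sum, RingHom.id_apply,
      LinearMap.smul_apply]
    exact sum_congr rfl fun I _ => by ring

lemma Tl_apply (g : Finset ι → K) : Tl x u g = T x u g := rfl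

/-- The unit for the shuffle product. -/
def vac (S : Finset ι) : K := if S = ∅ then 1 else 0

lemma T_vac : T x u (vac : Finset ι → K) = 1 := by
  ext f S
  rw [T_apply, star, sum_eq_single ∅]
  · simp [vac, Zk]
  · intro I _ hI
    rw [vac, if_neg hI, zero_mul, zero_mul]
  · simp

/-- Shows that the operator `T x u g` determines `g`. -/
lemma star_vac (g : Finset ι → K) : star x u g vac = g := by
  funext S
  rw [star, sum_eq_single S]
  · simp [vac, Zk]
  · intro I hI hIS
    rw [vac, if_neg, mul_zero, zero_mul]
    intro e
    exact hIS ((mem_powerset.1 hI).antisymm (sdiff_eq_empty_iff_subset.1 e))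
  · simp

lemma splitSum_congr_zpow (hx : ∀ i, x i ≠ 0) {w w' : ℕ → K → K → K} (n : ℤ) (S : Finset ι)
    (hw : ∀ a X Y, X ≠ 0 → Y ≠ 0 → w a X Y = (X * Y) ^ n * w' a X Y) :
    splitSum x u w S = (∏ i ∈ S, x i) ^ n * splitSum x u w' S := by
  rw [splitSum, splitSum, mul_sum]
  refine sum_congr rfl fun I hI => ?_
  rw [hw _ _ _ (prod_ne_zero_iff.2 fun i _ => hx i) (prod_ne_zero_iff.2 fun i _ => hx i),
    mul_comm (∏ i ∈ I, x i), prod_sdiff (mem_powerset.1 hI), mul_assoc]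

variable (h : Generic x u)
include h

/-- The factor `PP` turns the shuffle kernel into the symmetric-looking interaction `Om`; this is
why products of the functions `gg` are `PP` times a `splitSum`. -/
lemma PP_mul {I J : Finset ι} (hIJ : Disjoint I J) :
    PP x u I * PP x u J * Zk x u I J = PP x u (I ∪ J) * Om x u I J := by
  have e : ∏ p ∈ J ×ˢ I, (x p.1 - u * x p.2) / x p.1 =
      ∏ p ∈ I ×ˢ J, (x p.2 - u * x p.1) / x p.2 := by
    rw [prod_product_right, prod_product]
  have d1 : Disjoint I.offDiag J.offDiag := by
    rw [disjoint_left]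
    rintro ⟨a, b⟩ ha hb
    exact disjoint_left.1 hIJ (mem_offDiag.1 ha).1 (mem_offDiag.1 hb).1
  have d2 : Disjoint (I.offDiag ∪ J.offDiag) (I ×ˢ J) := by
    rw [disjoint_left]
    rintro ⟨a, b⟩ ha hb
    rw [mem_product] at hb
    rcases mem_union.1 ha with ha | ha
    · exact disjoint_left.1 hIJ (mem_offDiag.1 ha).2.1 hb.2
    · exact disjoint_left.1 hIJ hb.1 (mem_offDiag.1 ha).1
  have d3 : Disjoint (I.offDiag ∪ J.offDiag ∪ I ×ˢ J) (J ×ˢ I) := by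
    rw [disjoint_left]
    rintro ⟨a, b⟩ ha hb
    rw [mem_product] at hb
    rcases mem_union.1 ha with ha | ha
    rcases mem_union.1 ha with ha | ha
    · exact disjoint_left.1 hIJ (mem_offDiag.1 ha).1 hb.1
    · exact disjoint_left.1 hIJ hb.2 (mem_offDiag.1 ha).2.1
    · exact disjoint_left.1 hIJ (mem_product.1 ha).1 hb.1
  have e2 : (∏ p ∈ I ×ˢ J, (x p.1 - u * x p.2) / x p.1) *
      (∏ p ∈ I ×ˢ J, (x p.2 - u * x p.1) / x p.2) * Om x u I J = Zk x u I J := by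
    rw [Om, Zk, ← prod_product', ← prod_product', ← prod_mul_distrib, ← prod_mul_distrib]
    refine prod_congr rfl fun p hp => ?_
    have hp' := mem_product.1 hp
    have h1 : x p.1 - x p.2 ≠ 0 := sub_ne_zero.2 fun e =>
      disjoint_left.1 hIJ hp'.1 (h.inj _ _ e ▸ hp'.2)
    have h2 : x p.2 - u * x p.1 ≠ 0 := sub_ne_zero.2 (h.ne_u _ _)
    have h2' : x p.2 - x p.1 * u ≠ 0 := by rwa [mul_comm u] at h2
    have h3 := h.ne_zero p.1
    have h4 := h.ne_zero p.2
    rw [om]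
    field_simp
  rw [PP, PP, PP, offDiag_union hIJ, prod_union d3, prod_union d2, prod_union d1, e, ← e2]
  ring

lemma star_gg (α β : ℕ) (n p : ℤ) (S : Finset ι) :
    star x u (gg x u α n) (gg x u β p) S = if #S = α + β then
      PP x u S * splitSum x u (fun a X Y => if a = α then X ^ n * Y ^ p else 0) S else 0 := by
  split_ifs with hS
  · rw [star, splitSum, mul_sum]
    refine sum_congr rfl fun I hI => ?_
    have hc : #(S \ I) + #I = #S := card_sdiff_add_card_eq_card (mem_powerset.1 hI)
    by_cases h1 : #I = α
    · have e := PP_mul h (disjoint_sdiff : Disjoint I (S \ I))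
      rw [union_sdiff_of_subset (mem_powerset.1 hI)] at e
      rw [gg, gg, if_pos h1, if_pos (by omega), if_pos h1]
      linear_combination ((∏ i ∈ I, x i) ^ n * (∏ j ∈ S \ I, x j) ^ p) * e
    · rw [gg, if_neg h1, if_neg h1]; ring
  · refine sum_eq_zero fun I hI => ?_
    have hc : #(S \ I) + #I = #S := card_sdiff_add_card_eq_card (mem_powerset.1 hI)
    by_cases h1 : #I = α
    · rw [gg, gg, if_neg (by omega : ¬ #(S \ I) = β)]; ring
    · rw [gg, if_neg h1]; ring

lemma star_same (α β : ℕ) (n : ℤ) :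
    star x u (gg x u α n) (gg x u β n) = star x u (gg x u β n) (gg x u α n) := by
  funext S
  rw [star_gg h, star_gg h, add_comm β α]
  split_ifs with hS
  · have := splitSum_same h α β S hS
    have e : ∀ γ : ℕ, splitSum x u (fun a X Y => if a = γ then X ^ n * Y ^ n else 0) S =
        (∏ i ∈ S, x i) ^ n * splitSum x u (fun a _ _ => if a = γ then 1 else 0) S := fun γ =>
      splitSum_congr_zpow h.ne_zero n S fun a X Y _ _ => by rw [mul_zpow]; simp
    rw [splitSum_sub, sub_eq_zero] at this
    rw [e, e, this]
  · rfl

lemma star_next (α β : ℕ) (n : ℤ) :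
    star x u (gg x u α n) (gg x u β (n + 1)) =
      u ^ min α β • star x u (gg x u β (n + 1)) (gg x u α n) := by
  funext S
  rw [Pi.smul_apply, smul_eq_mul, star_gg h, star_gg h, add_comm β α]
  split_ifs with hS
  · have := splitSum_next h α β S hS
    have e1 : splitSum x u (fun a X Y => if a = α then X ^ n * Y ^ (n + 1) else 0) S =
        (∏ i ∈ S, x i) ^ n * splitSum x u (fun a _ Y => if a = α then Y else 0) S :=
      splitSum_congr_zpow h.ne_zero n S fun a X Y _ hY => by
        rw [mul_zpow, zpow_add_one₀ hY]; split_ifs <;> ring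
    have e2 : splitSum x u (fun a X Y => if a = β then X ^ (n + 1) * Y ^ n else 0) S =
        (∏ i ∈ S, x i) ^ n * splitSum x u (fun a X _ => if a = β then X else 0) S :=
      splitSum_congr_zpow h.ne_zero n S fun a X Y hX _ => by
        rw [mul_zpow, zpow_add_one₀ hX]; split_ifs <;> ring
    rw [splitSum_sub, splitSum_mul_left, sub_eq_zero] at this
    rw [e1, e2, this]
    ring
  · rw [mul_zero]

lemma star_msys (α : ℕ) (n : ℤ) :
    u ^ (α + 1) • star x u (gg x u (α + 1) (n + 1)) (gg x u (α + 1) (n - 1)) =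
      star x u (gg x u (α + 1) n) (gg x u (α + 1) n) -
        star x u (gg x u (α + 2) n) (gg x u α n) := by
  funext S
  rw [Pi.smul_apply, Pi.sub_apply, smul_eq_mul, star_gg h, star_gg h, star_gg h,
    show α + 2 + α = α + 1 + (α + 1) by ring]
  split_ifs with hS
  · have := splitSum_msys h α S (by omega)
    have e1 : splitSum x u (fun a X Y => if a = α + 1 then X ^ (n + 1) * Y ^ (n - 1) else 0) S =
        (∏ i ∈ S, x i) ^ (n - 1) *
          splitSum x u (fun a X _ => if a = α + 1 then X ^ 2 else 0) S :=
      splitSum_congr_zpow h.ne_zero (n - 1) S fun a X Y hX hY => by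
        rw [mul_zpow, show n + 1 = n - 1 + 2 by ring, zpow_add₀ hX]
        split_ifs
        · norm_cast; ring
        · ring
    have e2 : ∀ γ, splitSum x u (fun a X Y => if a = γ then X ^ n * Y ^ n else 0) S =
        (∏ i ∈ S, x i) ^ (n - 1) *
          splitSum x u (fun a X Y => if a = γ then X * Y else 0) S := fun γ =>
      splitSum_congr_zpow h.ne_zero (n - 1) S fun a X Y hX hY => by
        rw [mul_zpow, zpow_sub_one₀ hX, zpow_sub_one₀ hY]
        split_ifs
        · field_simp
        · ring
    rw [splitSum_sub, splitSum_mul_left, splitSum_sub, sub_eq_zero] at this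
    rw [e1, e2, e2]
    linear_combination (PP x u S * (∏ i ∈ S, x i) ^ (n - 1)) * this
  · ring

/-- Only sets of two variables contribute, where the claim is an identity of rational functions. -/
lemma star_exch (a b : ℤ) :
    star x u (gg x u 1 (a - 1)) (gg x u 1 b) - u • star x u (gg x u 1 b) (gg x u 1 (a - 1)) +
      (star x u (gg x u 1 (b - 1)) (gg x u 1 a) -
        u • star x u (gg x u 1 a) (gg x u 1 (b - 1))) = 0 := by
  funext S
  simp only [Pi.smul_apply, Pi.sub_apply, Pi.add_apply, Pi.zero_apply, smul_eq_mul, star_one]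
  by_cases hS : #S = 2
  · obtain ⟨i, j, hij, rfl⟩ := card_eq_two.1 hS
    have hji : j ≠ i := hij.symm
    have h1 : x i - x j ≠ 0 := sub_ne_zero.2 fun e => hij (h.inj _ _ e)
    have h2 : x j - x i ≠ 0 := sub_ne_zero.2 fun e => hji (h.inj _ _ e)
    have k1 : ({i, j} : Finset ι).erase i = {j} := by
      rw [erase_insert]; simpa using hij
    have k2 : ({i, j} : Finset ι).erase j = {i} := by
      rw [pair_comm, erase_insert]; simpa using hji
    have g1 : ∀ (n : ℤ) (l : ι), gg x u 1 n {l} = x l ^ n := by simp [gg, PP]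
    simp only [sum_pair hij, k1, k2, g1, Zk, prod_singleton, zpow_sub_one₀ (h.ne_zero _)]
    have h3 := h.ne_zero i
    have h4 := h.ne_zero j
    field_simp
    ring
  · have k0 : ∀ (n m : ℤ), ∑ i ∈ S, x i ^ n * Zk x u {i} (S.erase i) * gg x u 1 m (S.erase i) = 0 :=
      fun n m => sum_eq_zero fun i hi => by
        have := card_erase_add_one hi
        rw [gg, if_neg (by omega), mul_zero]
    simp only [k0]
    ring

end Shuffle

end QuantumQ

end

noncomputable section

namespace QuantumQ

open Finset

/-! ### Quantum determinants in the shuffle algebra -/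

section Determinant

variable {ι K : Type} [DecidableEq ι] [Field K] (x : ι → K) (u : K)

/-- The function representing the word `e_{l_1} ⋯ e_{l_k}`. -/
def wd : List ℤ → Finset ι → K
  | [] => vac
  | a :: l => star x u (gg x u 1 a) (wd l)

/-- The shuffle symmetrization of a function of `k` variables. -/
def Sm : (k : ℕ) → ((Fin k → ι) → K) → Finset ι → K
  | 0, φ, S => if S = ∅ then φ Fin.elim0 else 0
  | k + 1, φ, S =>
    ∑ i ∈ S, Zk x u {i} (S.erase i) * Sm k (fun t => φ (Fin.cons i t)) (S.erase i)

variable {x u}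

lemma T_wd (l : List ℤ) : (l.map fun a => T x u (gg x u 1 a)).prod = T x u (wd x u l) := by
  induction l with
  | nil => exact T_vac.symm
  | cons a l ih => rw [List.map_cons, List.prod_cons, ih, T_mul, wd]

lemma Sm_sum {β : Type} (s : Finset β) (k : ℕ) (φ : β → (Fin k → ι) → K) (S : Finset ι) :
    Sm x u k (fun t => ∑ d ∈ s, φ d t) S = ∑ d ∈ s, Sm x u k (φ d) S := by
  induction k generalizing S with
  | zero => simp only [Sm]; split_ifs <;> simp
  | succ k ih =>
    simp only [Sm]
    rw [sum_comm]
    refine sum_congr rfl fun i _ => ?_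
    rw [ih (fun d t => φ d (Fin.cons i t)), mul_sum]

lemma Sm_const_mul (r : K) (k : ℕ) (φ : (Fin k → ι) → K) (S : Finset ι) :
    Sm x u k (fun t => r * φ t) S = r * Sm x u k φ S := by
  induction k generalizing S with
  | zero => simp only [Sm]; split_ifs <;> simp
  | succ k ih =>
    simp only [Sm, mul_sum]
    refine sum_congr rfl fun i _ => ?_
    rw [ih]
    ring

/-- A factor symmetric in the variables depends only on the underlying set and leaves the
symmetrization. -/
lemma Sm_prod_mul (c : ι → K) (k : ℕ) (φ : (Fin k → ι) → K) (S : Finset ι) :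
    Sm x u k (fun t => (∏ b, c (t b)) * φ t) S = (∏ j ∈ S, c j) * Sm x u k φ S := by
  induction k generalizing S with
  | zero =>
    simp only [Sm]
    split_ifs with hS
    · simp [hS]
    · simp
  | succ k ih =>
    simp only [Sm, mul_sum]
    refine sum_congr rfl fun i hi => ?_
    have e : (fun t : Fin k → ι => (∏ b, c ((Fin.cons i t : Fin (k + 1) → ι) b)) *
        φ (Fin.cons i t)) = fun t => (∏ b, c (t b)) * (c i * φ (Fin.cons i t)) := by
      funext t
      rw [Fin.prod_univ_succ]
      simp only [Fin.cons_zero, Fin.cons_succ]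
      ring
    rw [e, ih, Sm_const_mul, ← mul_prod_erase S c hi]
    ring

lemma wd_ofFn (k : ℕ) (a : Fin k → ℤ) (S : Finset ι) :
    wd x u (List.ofFn a) S = Sm x u k (fun t => ∏ i, x (t i) ^ a i) S := by
  induction k generalizing S with
  | zero => simp [wd, Sm, vac]
  | succ k ih =>
    rw [List.ofFn_succ, wd, star_one, Sm]
    refine sum_congr rfl fun i _ => ?_
    rw [ih]
    simp only [Fin.prod_univ_succ, Fin.cons_zero, Fin.cons_succ]
    rw [Sm_const_mul]
    ring

/-- The Lagrange basis polynomials at the nodes `(x i)⁻¹` sum to 1; evaluate at 0. -/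
lemma sum_prod_div_sub (hx : ∀ i, x i ≠ 0) (hinj : ∀ i j, x i = x j → i = j) {S : Finset ι}
    (hS : S.Nonempty) : ∑ i ∈ S, ∏ j ∈ S.erase i, x i / (x i - x j) = 1 := by
  have h1 : Set.InjOn (fun i => (x i)⁻¹) S := fun i _ j _ e => hinj _ _ (inv_injective e)
  have h2 := congrArg (Polynomial.eval 0) (Lagrange.sum_basis h1 hS)
  rw [Polynomial.eval_finsetSum, Polynomial.eval_one] at h2
  rw [← h2]
  refine sum_congr rfl fun i _ => ?_
  rw [Lagrange.basis, Polynomial.eval_prod]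
  refine prod_congr rfl fun j hj => ?_
  have hij : x i - x j ≠ 0 := sub_ne_zero.2 fun e => (mem_erase.1 hj).1 (hinj _ _ e).symm
  have hji : x j - x i ≠ 0 := sub_ne_zero.2 fun e => (mem_erase.1 hj).1 (hinj _ _ e)
  have hi := hx i
  have hj' := hx j
  have e : (x i)⁻¹ - (x j)⁻¹ = (x j - x i) / (x i * x j) := by field_simp
  simp only [Lagrange.basisDivisor, Polynomial.eval_mul, Polynomial.eval_C, Polynomial.eval_sub,
    Polynomial.eval_X, e]
  field_simp
  ring

variable (x u) in
/-- The `q`-Vandermonde product times the `n`-th power of the product of the variables. -/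
def Vd (n : ℤ) (k : ℕ) (t : Fin k → ι) : K :=
  (∏ i, x (t i) ^ n) * ∏ p : Fin k × Fin k with p.1 < p.2, (1 - u * x (t p.1) / x (t p.2))

omit [DecidableEq ι] in
lemma Vd_cons (n : ℤ) (k : ℕ) (i : ι) (t : Fin k → ι) :
    Vd x u n (k + 1) (Fin.cons i t) =
      (∏ b, (1 - u * x i / x (t b))) * (x i ^ n * Vd x u n k t) := by
  have e : ∀ (m : ℕ) (f : Fin m → Fin m → K),
      ∏ p : Fin m × Fin m with p.1 < p.2, f p.1 p.2 = ∏ a, ∏ b, if a < b then f a b else 1 := by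
    intro m f
    rw [prod_filter, ← univ_product_univ, prod_product]
  rw [Vd, Vd, e _ fun a b => 1 - u * x ((Fin.cons i t : Fin (k + 1) → ι) a) /
    x ((Fin.cons i t : Fin (k + 1) → ι) b), e _ fun a b => 1 - u * x (t a) / x (t b)]
  simp only [Fin.prod_univ_succ, Fin.cons_zero, Fin.cons_succ, Fin.succ_lt_succ_iff,
    Fin.not_lt_zero, if_false, Fin.succ_pos, if_true, one_mul]
  ring

/-- Induction by splitting off the first variable: its factors against the others are symmetric in
the others and come out, the rest is `gg` by induction, and what remains of the sum over the first
variable is `sum_prod_div_sub`. -/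
lemma Sm_Vd (h : Generic x u) (n : ℤ) (k : ℕ) (S : Finset ι) :
    Sm x u k (Vd x u n k) S = gg x u k n S := by
  induction k generalizing S with
  | zero =>
    rcases S.eq_empty_or_nonempty with rfl | hS
    · simp [Sm, gg, Vd, PP]
    · simp [Sm, gg, hS.ne_empty]
  | succ k ih =>
    simp only [Sm, Vd_cons]
    have e : ∀ i ∈ S, Sm x u k (fun t => (∏ b, (1 - u * x i / x (t b))) * (x i ^ n * Vd x u n k t))
        (S.erase i) = (∏ j ∈ S.erase i, (1 - u * x i / x j)) * (x i ^ n *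
          gg x u k n (S.erase i)) := by
      intro i _
      rw [Sm_prod_mul (fun j => 1 - u * x i / x j), Sm_const_mul, ih]
    by_cases hS : #S = k + 1
    · have hne : S.Nonempty := card_pos.1 (by omega)
      have key := congrArg (fun z => (∏ i ∈ S, x i) ^ n * PP x u S * z)
        (sum_prod_div_sub h.ne_zero h.inj hne)
      simp only [mul_one, mul_sum] at key
      rw [gg, if_pos hS, ← key]
      refine sum_congr rfl fun i hi => ?_
      have hc := card_erase_add_one hi
      have hd : Disjoint {i} (S.erase i) := by simp
      have hP := PP_mul h hd
      rw [← insert_eq, insert_erase hi, show PP x u {i} = 1 by simp [PP], one_mul] at hP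
      have hO : Om x u {i} (S.erase i) * ∏ j ∈ S.erase i, (1 - u * x i / x j) =
          ∏ j ∈ S.erase i, x i / (x i - x j) := by
        rw [Om, prod_singleton, ← prod_mul_distrib]
        refine prod_congr rfl fun j hj => ?_
        have h1 : x i - x j ≠ 0 := sub_ne_zero.2 fun e => (mem_erase.1 hj).1 (h.inj _ _ e).symm
        have h2 : x j - u * x i ≠ 0 := sub_ne_zero.2 (h.ne_u _ _)
        have h3 := h.ne_zero j
        rw [om, one_sub_div h3, div_mul_div_comm, div_eq_div_iff
          (mul_ne_zero (mul_ne_zero h1 h2) h3) h1]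
        ring
      rw [e i hi, gg, if_pos (by omega), ← hO, ← mul_prod_erase S x hi, mul_zpow]
      linear_combination (x i ^ n * (∏ j ∈ S.erase i, x j) ^ n *
        ∏ j ∈ S.erase i, (1 - u * x i / x j)) * hP
    · rw [gg, if_neg hS]
      refine sum_eq_zero fun i hi => ?_
      have hc := card_erase_add_one hi
      rw [e i hi, gg, if_neg (by omega)]
      ring

end Determinant

lemma map_qDet {A B : Type} [Ring A] [Algebra Zq A] [Ring B] [Algebra Zq B] (f : A →ₐ[Zq] B)
    (m : ℤ → A) (α : ℕ) (n : ℤ) : f (qDet m α n) = qDet (fun k => f (m k)) α n := by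
  simp only [qDet, Finsupp.sum, map_sum, map_smul, map_list_prod, List.map_ofFn]
  rfl

/-! ### The current algebra acting on functions of finite sets -/

section Realization

variable {ι K : Type} [DecidableEq ι] [Field K] [Algebra Zq K] (x : ι → K)

/-- Evaluation of Laurent polynomials at the inverses of a tuple of variables. -/
def evInv {k : ℕ} (hx : ∀ i, x i ≠ 0) (t : Fin k → ι) :
    AddMonoidAlgebra Zq (Fin k → ℤ) →ₐ[Zq] K :=
  AddMonoidAlgebra.lift Zq K (Fin k → ℤ)
    { toFun := fun d => ∏ i, x (t i) ^ (-(d.toAdd i))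
      map_one' := by simp
      map_mul' := fun a b => by
        rw [← prod_mul_distrib]
        refine prod_congr rfl fun i _ => ?_
        rw [toAdd_mul, Pi.add_apply, neg_add, zpow_add₀ (hx _)] }

variable {x}

omit [DecidableEq ι] in
-- Evaluation is at inverses because the monomial `u^d` contributes the letters `n - d i`; hence
-- `u_b / u_a` becomes `x_a / x_b`.
lemma evInv_qVandermonde {k : ℕ} (hx : ∀ i, x i ≠ 0) (t : Fin k → ι) :
    evInv x hx t (qVandermonde k) =
      ∏ p : Fin k × Fin k with p.1 < p.2, (1 - algebraMap Zq K q * x (t p.1) / x (t p.2)) := by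
  rw [qVandermonde, map_prod]
  refine prod_congr rfl fun p hp => ?_
  have hne : p.1 ≠ p.2 := (mem_filter.1 hp).2.ne
  rw [map_sub, map_one, evInv, AddMonoidAlgebra.lift_single, Algebra.smul_def, mul_div_assoc]
  congr 2
  simp only [MonoidHom.coe_mk, OneHom.coe_mk, toAdd_ofAdd, Pi.sub_apply, neg_sub]
  have : ∀ i, x (t i) ^ ((Pi.single p.1 1 : Fin k → ℤ) i - (Pi.single p.2 1 : Fin k → ℤ) i) =
      (if i = p.1 then x (t i) else 1) * (if i = p.2 then (x (t i))⁻¹ else 1) := by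
    intro i
    rw [zpow_sub₀ (hx _), div_eq_mul_inv, Pi.single_apply, Pi.single_apply]
    split_ifs <;> simp
  simp only [this, prod_mul_distrib, prod_ite_eq', mem_univ, if_true, div_eq_mul_inv]

/-- The quantum determinants in the shuffle realization. -/
lemma qDet_T (h : Generic x (algebraMap Zq K q)) (α : ℕ) (n : ℤ) :
    qDet (fun a => T x (algebraMap Zq K q) (gg x (algebraMap Zq K q) 1 a)) α n =
      T x (algebraMap Zq K q) (gg x (algebraMap Zq K q) α n) := by
  set u := algebraMap Zq K q with hu
  have e1 : ∀ d : Fin α → ℤ, (List.ofFn fun i => T x u (gg x u 1 (n - d i))).prod =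
      T x u (wd x u (List.ofFn fun i => n - d i)) := by
    intro d
    rw [← T_wd, List.map_ofFn]
    rfl
  have e2 : ∀ (c : Zq) (g : Finset ι → K), c • T x u g = T x u (algebraMap Zq K c • g) := by
    intro c g
    rw [← Tl_apply, ← Tl_apply, map_smul, algebraMap_smul]
  rw [qDet]
  simp only [e1, e2, Finsupp.sum]
  simp only [← Tl_apply]
  rw [← map_sum]
  congr 1
  funext S
  rw [Finset.sum_apply]
  simp only [Pi.smul_apply, smul_eq_mul, wd_ofFn, ← Sm_const_mul]
  rw [← Sm_sum, ← Sm_Vd h]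
  congr 1
  funext t
  rw [Vd, ← evInv_qVandermonde h.ne_zero, evInv, AddMonoidAlgebra.lift_apply, Finsupp.sum, mul_sum]
  refine sum_congr rfl fun d _ => ?_
  simp only [MonoidHom.coe_mk, OneHom.coe_mk, toAdd_ofAdd, sub_eq_add_neg, zpow_add₀ (h.ne_zero _),
    prod_mul_distrib, Algebra.smul_def]
  ring

/-- The shuffle realization of the current algebra. -/
def shuffle (x : ι → K) (h : Generic x (algebraMap Zq K q)) :
    CurAlg →ₐ[Zq] Module.End K (Finset ι → K) :=
  RingQuot.liftAlgHom Zq ⟨FreeAlgebra.lift Zq fun a =>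
    T x (algebraMap Zq K q) (gg x (algebraMap Zq K q) 1 a), by
    have e2 : ∀ (g : Finset ι → K), q • T x (algebraMap Zq K q) g =
        T x (algebraMap Zq K q) (algebraMap Zq K q • g) := by
      intro g
      rw [← Tl_apply, ← Tl_apply, map_smul, algebraMap_smul]
    rintro _ _ (⟨a, b, -⟩ | ⟨a⟩)
    · simp only [qComm, map_add, map_sub, map_mul, map_smul, FreeAlgebra.lift_ι_apply, map_zero,
        T_mul, e2]
      simp only [← Tl_apply]
      rw [← map_sub, ← map_sub, ← map_add, star_exch h, map_zero]
    · simp only [qComm, map_sub, map_mul, map_smul, FreeAlgebra.lift_ι_apply, map_zero, T_mul, e2]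
      have := star_next h 1 1 (a - 1)
      rw [sub_add_cancel, min_self, pow_one] at this
      rw [this, sub_self]⟩

lemma shuffle_e (h : Generic x (algebraMap Zq K q)) (a : ℤ) :
    shuffle x h (CurAlg.e a) = T x (algebraMap Zq K q) (gg x (algebraMap Zq K q) 1 a) := by
  rw [shuffle, CurAlg.e, RingQuot.liftAlgHom_mkAlgHom_apply, FreeAlgebra.lift_ι_apply]

lemma shuffle_qDet (h : Generic x (algebraMap Zq K q)) (α : ℕ) (n : ℤ) :
    shuffle x h (qDet CurAlg.e α n) =
      T x (algebraMap Zq K q) (gg x (algebraMap Zq K q) α n) := by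
  refine (map_qDet (shuffle x h) CurAlg.e α n).trans ?_
  rw [← qDet_T h]
  simp only [shuffle_e]

lemma smul_T (c : Zq) (g : Finset ι → K) : c • T x (algebraMap Zq K q) g =
    T x (algebraMap Zq K q) (algebraMap Zq K c • g) := by
  rw [← Tl_apply, ← Tl_apply, map_smul, algebraMap_smul]

end Realization

end QuantumQ

end

noncomputable section

namespace QuantumQ

open Finset

/-! ### Decreasing words span the current algebra -/

/-- The word `e_{l_1} ⋯ e_{l_k}` in the current algebra. -/
def cw (l : List ℤ) : CurAlg := (l.map CurAlg.e).prod

lemma CurAlg.exch_eq_zero {a b : ℤ} (h : a ≠ b) : exch CurAlg.e a b = 0 := by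
  have := RingQuot.mkAlgHom_rel Zq (ExchangeRel.offDiag a b h)
  simp only [qComm, map_add, map_sub, map_mul, map_smul, map_zero] at this
  exact this

lemma CurAlg.qComm_eq_zero (a : ℤ) : qComm (CurAlg.e (a - 1)) (CurAlg.e a) = 0 := by
  have := RingQuot.mkAlgHom_rel Zq (ExchangeRel.diag a)
  simp only [qComm, map_sub, map_mul, map_smul, map_zero] at this
  exact this

/-- Rewriting rule: for `b ≥ a + 2` each word on the right begins with a letter larger than `a`. -/
lemma mul_eq_of_exch {A : Type} [Ring A] [Algebra Zq A] {f : ℤ → A} {a b : ℤ}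
    (h : exch f (a + 1) b = 0) (y : A) : f a * f b * y =
      q • (f b * (f a * y)) + (-1 : Zq) • (f (b - 1) * (f (a + 1) * y)) +
        q • (f (a + 1) * (f (b - 1) * y)) := by
  rw [exch, add_sub_cancel_right, qComm, qComm] at h
  have e : f a * f b = q • (f b * f a) - f (b - 1) * f (a + 1) + q • (f (a + 1) * f (b - 1)) := by
    rw [← sub_eq_zero, ← h]; abel
  rw [e, add_mul, sub_mul, smul_mul_assoc, smul_mul_assoc, mul_assoc, mul_assoc, mul_assoc,
    neg_one_smul, ← sub_eq_add_neg]

/-- The span of decreasing words of length `k` with letters at most `B`. -/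
def decSpan (k : ℕ) (B : ℤ) : Submodule Zq CurAlg :=
  Submodule.span Zq (cw '' {l | l.length = k ∧ l.Pairwise (· ≥ ·) ∧ ∀ z ∈ l, z ≤ B})

/-- Outer induction on the length, inner induction on `B - a`. Rewriting an ascent at the front
strictly raises the first letter and never exceeds `B`, so the process stops. -/
lemma e_mul_mem_decSpan (k : ℕ) (B a : ℤ) (ha : a ≤ B) (y : CurAlg) (hy : y ∈ decSpan k B) :
    CurAlg.e a * y ∈ decSpan (k + 1) B := by
  induction k generalizing a y with
  | zero =>
    refine Submodule.span_induction (p := fun y _ => CurAlg.e a * y ∈ decSpan 1 B) ?_ ?_ ?_ ?_ hy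
    · rintro _ ⟨l, ⟨hl, -, -⟩, rfl⟩
      rw [List.length_eq_zero_iff] at hl
      subst hl
      exact Submodule.subset_span ⟨[a], by simpa using ha, by simp [cw]⟩
    · rw [mul_zero]; exact zero_mem _
    · intro y z _ _ h1 h2; rw [mul_add]; exact add_mem h1 h2
    · intro c y _ h1; rw [mul_smul_comm]; exact Submodule.smul_mem _ _ h1
  | succ k ih =>
    obtain ⟨n, hn⟩ : ∃ n : ℕ, (B - a).toNat = n := ⟨_, rfl⟩
    induction n using Nat.strong_induction_on generalizing a y with
    | _ n ih2 =>
      refine Submodule.span_induction (p := fun y _ => CurAlg.e a * y ∈ decSpan (k + 1 + 1) B)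
        ?_ ?_ ?_ ?_ hy
      · rintro _ ⟨l, ⟨hl, hp, hB⟩, rfl⟩
        obtain ⟨b, l, rfl⟩ := List.exists_cons_of_length_eq_add_one hl
        rw [List.length_cons, Nat.add_right_cancel_iff] at hl
        rw [List.pairwise_cons] at hp
        have hbB : b ≤ B := hB b (by simp)
        rcases le_or_gt b a with hba | hab
        · refine Submodule.subset_span ⟨a :: b :: l, ⟨by simp [hl], ?_, ?_⟩, by simp [cw]⟩
          · rw [List.pairwise_cons]
            refine ⟨fun z hz => ?_, List.pairwise_cons.2 hp⟩
            rcases List.mem_cons.1 hz with rfl | hz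
            · exact hba
            · exact (hp.1 z hz).trans hba
          · intro z hz
            rcases List.mem_cons.1 hz with rfl | hz
            · exact ha
            · exact hB z hz
        · have hw : cw l ∈ decSpan k B :=
            Submodule.subset_span ⟨l, ⟨hl, hp.2, fun z hz => hB z (by simp [hz])⟩, rfl⟩
          have hc : ∀ c d : ℤ, a < c → c ≤ B → d ≤ B →
              CurAlg.e c * (CurAlg.e d * cw l) ∈ decSpan (k + 1 + 1) B := fun c d h1 h2 h3 =>
            ih2 _ (by omega) c h2 _ (ih d h3 _ hw) rfl
          have hcw : CurAlg.e a * cw (b :: l) = CurAlg.e a * CurAlg.e b * cw l := by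
            simp [cw, mul_assoc]
          rw [hcw]
          -- For adjacent letters the exchange component has equal indices, so the separate diagonal
          -- relation is used.
          rcases eq_or_ne (a + 1) b with rfl | hne
          · have := CurAlg.qComm_eq_zero (a + 1)
            rw [add_sub_cancel_right, qComm, sub_eq_zero] at this
            rw [this, smul_mul_assoc, mul_assoc]
            exact Submodule.smul_mem _ _ (hc _ _ (by omega) hbB ha)
          · rw [mul_eq_of_exch (CurAlg.exch_eq_zero hne)]
            exact add_mem (add_mem (Submodule.smul_mem _ _ (hc _ _ hab hbB ha))
              (Submodule.smul_mem _ _ (hc _ _ (by omega) (by omega) (by omega))))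
              (Submodule.smul_mem _ _ (hc _ _ (by omega) (by omega) (by omega)))
      · rw [mul_zero]; exact zero_mem _
      · intro y z _ _ h1 h2; rw [mul_add]; exact add_mem h1 h2
      · intro c y _ h1; rw [mul_smul_comm]; exact Submodule.smul_mem _ _ h1

lemma exists_le_of_list (l : List ℤ) (a : ℤ) : ∃ B, a ≤ B ∧ ∀ z ∈ l, z ≤ B := by
  induction l with
  | nil => exact ⟨a, le_rfl, by simp⟩
  | cons b l ih =>
    obtain ⟨B, h1, h2⟩ := ih
    refine ⟨max b B, h1.trans (le_max_right _ _), fun z hz => ?_⟩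
    rcases List.mem_cons.1 hz with rfl | hz
    · exact le_max_left _ _
    · exact (h2 z hz).trans (le_max_right _ _)

lemma mem_span_cw (x : CurAlg) :
    x ∈ Submodule.span Zq (cw '' {l | l.Pairwise (· ≥ ·)}) := by
  set W := Submodule.span Zq (cw '' {l : List ℤ | l.Pairwise (· ≥ ·)}) with hW
  have hle : ∀ k B, decSpan k B ≤ W := fun k B =>
    Submodule.span_mono (Set.image_mono fun l hl => hl.2.1)
  have he : ∀ a, ∀ y ∈ W, CurAlg.e a * y ∈ W := by
    intro a y hy
    refine Submodule.span_induction (p := fun y _ => CurAlg.e a * y ∈ W) ?_ ?_ ?_ ?_ hy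
    · rintro _ ⟨l, hl, rfl⟩
      obtain ⟨B, h1, h2⟩ := exists_le_of_list l a
      exact hle _ _ (e_mul_mem_decSpan l.length B a h1 _
        (Submodule.subset_span ⟨l, ⟨rfl, hl, h2⟩, rfl⟩))
    · rw [mul_zero]; exact zero_mem _
    · intro y z _ _ h1 h2; rw [mul_add]; exact add_mem h1 h2
    · intro c y _ h1; rw [mul_smul_comm]; exact Submodule.smul_mem _ _ h1
  have key : ∀ z : FreeAlgebra Zq ℤ, ∀ y ∈ W, RingQuot.mkAlgHom Zq ExchangeRel z * y ∈ W := by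
    intro z
    induction z using FreeAlgebra.induction with
    | grade0 c =>
      intro y hy
      rw [AlgHom.commutes, ← Algebra.smul_def]
      exact Submodule.smul_mem _ _ hy
    | grade1 a => exact he a
    | mul z w hz hw =>
      intro y hy
      rw [map_mul, mul_assoc]
      exact hz _ (hw _ hy)
    | add z w hz hw =>
      intro y hy
      rw [map_add, add_mul]
      exact add_mem (hz _ hy) (hw _ hy)
  obtain ⟨z, rfl⟩ := RingQuot.mkAlgHom_surjective Zq ExchangeRel x
  have := key z 1 (Submodule.subset_span ⟨[], List.Pairwise.nil, by simp [cw]⟩)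
  rwa [mul_one] at this

/-! ### Independence of decreasing words -/

section Independence

open Filter Topology

/-- The sequence of variables `1, 2, 3, …`. -/
def xN (i : ℕ) : ℝ := i + 1

lemma tendsto_xN : Tendsto xN atTop atTop :=
  tendsto_atTop_add_const_right _ _ tendsto_natCast_atTop_atTop

lemma xN_inj {i j : ℕ} (h : xN i = xN j) : i = j := by
  unfold xN at h
  exact_mod_cast add_right_cancel h

lemma xN_pos (i : ℕ) : 0 < xN i := by unfold xN; positivity

variable {u : ℝ}

lemma wd_card (l : List ℤ) (S : Finset ℕ) (h : #S ≠ l.length) : wd xN u l S = 0 := by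
  induction l generalizing S with
  | nil =>
    rw [wd, vac, if_neg]
    rintro rfl
    exact h rfl
  | cons a l ih =>
    rw [wd, star_one]
    refine sum_eq_zero fun i hi => ?_
    have := card_erase_add_one hi
    rw [List.length_cons] at h
    rw [ih _ (by omega), mul_zero]

variable (u) in
/-- The leading coefficient of a word as one variable tends to infinity. -/
def lead (A : ℤ) : List ℤ → Finset ℕ → ℝ
  | [], _ => 0
  | a :: l, S => (if a = A then wd xN u l S else 0) +
      ∑ i ∈ S, xN i ^ a * (u * Zk xN u {i} (S.erase i)) * lead A l (S.erase i)

lemma tendsto_ratio (c r d : ℝ) :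
    Tendsto (fun n => (d - c * xN n) / (r - xN n)) atTop (𝓝 c) := by
  have h1 : Tendsto (fun n => r - xN n) atTop atBot :=
    tendsto_const_nhds.add_atBot (tendsto_neg_atTop_atBot.comp tendsto_xN)
  have h2 : Tendsto (fun n => c + (d - c * r) / (r - xN n)) atTop (𝓝 (c + 0)) :=
    tendsto_const_nhds.add (tendsto_const_nhds.div_atBot h1)
  rw [add_zero] at h2
  refine h2.congr' ?_
  filter_upwards [h1.eventually_lt_atBot 0] with n hn
  have hne : r - xN n ≠ 0 := hn.ne
  rw [eq_div_iff hne, add_mul, div_mul_cancel₀ _ hne]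
  ring

/-- The large variable must take a letter equal to `A` to survive division by `x_n ^ A`. Each
variable placed before it contributes a factor tending to `u`, each one after it a factor tending to
1. -/
lemma tendsto_lead (A : ℤ) (l : List ℤ) (hl : ∀ z ∈ l, z ≤ A) (S : Finset ℕ) :
    Tendsto (fun n => wd xN u l (insert n S) / xN n ^ A) atTop (𝓝 (lead u A l S)) := by
  induction l generalizing S with
  | nil =>
    have : (fun n => wd xN u [] (insert n S) / xN n ^ A) = fun _ => 0 := by
      funext n
      rw [wd, vac, if_neg (insert_ne_empty _ _), zero_div]
    rw [this]
    exact tendsto_const_nhds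
  | cons a l ih =>
    have ha : a ≤ A := hl a (by simp)
    have ih' := ih fun z hz => hl z (by simp [hz])
    have t1 : Tendsto (fun n => xN n ^ a / xN n ^ A) atTop (𝓝 (if a = A then 1 else 0)) := by
      split_ifs with h
      · subst h
        have : (fun n => xN n ^ a / xN n ^ a) = fun _ => 1 := by
          funext n; exact div_self (zpow_ne_zero _ (xN_pos n).ne')
        rw [this]
        exact tendsto_const_nhds
      · have : (fun n => xN n ^ a / xN n ^ A) = fun n => (xN n) ^ (-(((A - a).toNat : ℕ) : ℤ)) := by
          funext n
          rw [← zpow_sub₀ (xN_pos n).ne']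
          congr 1
          omega
        rw [this]
        exact (tendsto_pow_neg_atTop (𝕜 := ℝ) (n := (A - a).toNat) (by omega)).comp tendsto_xN
    have t2 : Tendsto (fun n => Zk xN u {n} S) atTop (𝓝 1) := by
      have : ∀ j ∈ S, Tendsto (fun n => (xN n - u * xN j) / (xN n - xN j)) atTop (𝓝 1) := by
        intro j _
        refine (tendsto_ratio 1 (xN j) (u * xN j)).congr fun n => ?_
        rw [← neg_div_neg_eq]
        congr 1 <;> ring
      have := tendsto_finsetProd S this
      simpa [Zk] using this
    have t3 : ∀ i ∈ S, Tendsto (fun n => xN i ^ a * ((xN i - u * xN n) / (xN i - xN n) *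
        Zk xN u {i} (S.erase i)) * (wd xN u l (insert n (S.erase i)) / xN n ^ A)) atTop
        (𝓝 (xN i ^ a * (u * Zk xN u {i} (S.erase i)) * lead u A l (S.erase i))) := fun i _ =>
      ((tendsto_const_nhds.mul ((tendsto_ratio u (xN i) (xN i)).mul tendsto_const_nhds)).mul
        (ih' _))
    have t4 := ((t1.mul t2).mul (tendsto_const_nhds (x := wd xN u l S))).add
      (tendsto_finsetSum S t3)
    have e : (if a = A then (1 : ℝ) else 0) * 1 * wd xN u l S = if a = A then wd xN u l S else 0 := by
      split_ifs <;> ring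
    rw [e] at t4
    refine t4.congr' ?_
    filter_upwards [eventually_gt_atTop (S.sup id)] with n hn
    have hnS : n ∉ S := fun h => absurd (le_sup (f := id) h) (not_le.2 hn)
    rw [wd, star_one, sum_insert hnS, erase_insert hnS, add_div, sum_div]
    congr 1
    · ring
    · refine sum_congr rfl fun i hi => ?_
      have hin : n ≠ i := fun h => hnS (h ▸ hi)
      rw [erase_insert_of_ne hin]
      have : Zk xN u {i} (insert n (S.erase i)) =
          (xN i - u * xN n) / (xN i - xN n) * Zk xN u {i} (S.erase i) := by
        rw [Zk, Zk, prod_singleton, prod_singleton, prod_insert]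
        exact fun h => hnS (mem_of_mem_erase h)
      rw [this]
      ring

lemma lead_lt (A : ℤ) (l : List ℤ) (hl : ∀ z ∈ l, z < A) (S : Finset ℕ) : lead u A l S = 0 := by
  induction l generalizing S with
  | nil => rfl
  | cons a l ih =>
    have := hl a (by simp)
    rw [lead, if_neg (by omega), zero_add]
    refine sum_eq_zero fun i _ => ?_
    rw [ih (fun z hz => hl z (by simp [hz])), mul_zero]

/-- If `A` occurs `k` times, the constant is `1 + u + ⋯ + u ^ (k - 1)`, which is nonzero because `u
> 0`. -/
lemma lead_cons (hu : 0 < u) (A : ℤ) (l : List ℤ) (hl : (A :: l).Pairwise (· ≥ ·)) :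
    ∃ μ : ℝ, 0 < μ ∧ ∀ S, lead u A (A :: l) S = μ * wd xN u l S := by
  induction l with
  | nil =>
    refine ⟨1, one_pos, fun S => ?_⟩
    rw [lead, if_pos rfl, one_mul]
    simp [lead]
  | cons b l ih =>
    rw [List.pairwise_cons] at hl
    have hb : A ≥ b := hl.1 b (by simp)
    rcases hb.lt_or_eq with hb | rfl
    · refine ⟨1, one_pos, fun S => ?_⟩
      rw [lead, if_pos rfl, one_mul, sum_eq_zero, add_zero]
      intro i _
      rw [lead_lt, mul_zero]
      intro z hz
      rcases List.mem_cons.1 hz with rfl | hz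
      · exact hb
      · exact lt_of_le_of_lt ((List.pairwise_cons.1 hl.2).1 z hz) hb
    · obtain ⟨μ, h1, h2⟩ := ih hl.2
      refine ⟨1 + u * μ, by positivity, fun S => ?_⟩
      rw [lead, if_pos rfl, add_mul, one_mul]
      congr 1
      rw [wd, star_one, mul_sum]
      refine sum_congr rfl fun i _ => ?_
      rw [h2]
      ring

/-- Among words with nonzero coefficient take the largest first letter `A` and let one variable tend
to infinity, scaled by its `A`-th power. Words starting with a smaller letter disappear, the others
leave positive multiples of their tails, and induction on the length applies. -/
lemma wd_independent (hu : 0 < u) (k : ℕ) (s : Finset (List ℤ)) (f : List ℤ → ℝ)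
    (hs : ∀ l ∈ s, l.Pairwise (· ≥ ·) ∧ l.length = k)
    (h0 : ∀ S : Finset ℕ, #S = k → ∑ l ∈ s, f l * wd xN u l S = 0) : ∀ l ∈ s, f l = 0 := by
  induction k generalizing s f with
  | zero =>
    intro l hl
    have e : ∀ l ∈ s, l = [] := fun l hl => List.length_eq_zero_iff.1 (hs l hl).2
    have hs' : s = {l} := by
      ext l'
      rw [mem_singleton]
      exact ⟨fun h => (e l' h).trans (e l hl).symm, fun h => h ▸ hl⟩
    have := h0 ∅ rfl
    rw [hs', sum_singleton, e l hl] at this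
    rw [e l hl]
    simpa [wd, vac] using this
  | succ k ih =>
    by_contra hcon
    push Not at hcon
    obtain ⟨l0, hl0, hf0⟩ := hcon
    set s' := s.filter fun l => f l ≠ 0 with hs'
    have hne : s'.Nonempty := ⟨l0, mem_filter.2 ⟨hl0, hf0⟩⟩
    obtain ⟨lm, hlm, hmax⟩ := exists_max_image s' (fun l => l.headI) hne
    obtain ⟨A, tm, rfl⟩ := List.exists_cons_of_length_eq_add_one (hs lm (mem_filter.1 hlm).1).2
    simp only [List.headI_cons] at hmax
    have hle : ∀ l ∈ s', ∀ z ∈ l, z ≤ A := by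
      intro l hl z hz
      have h1 := hs l (mem_filter.1 hl).1
      have h2 := hmax l hl
      obtain ⟨a, t, rfl⟩ := List.exists_cons_of_length_eq_add_one h1.2
      rw [List.headI_cons] at h2
      rcases List.mem_cons.1 hz with rfl | hz
      · exact h2
      · exact ((List.pairwise_cons.1 h1.1).1 z hz).trans h2
    have key : ∀ S : Finset ℕ, #S = k → ∑ l ∈ s', f l * lead u A l S = 0 := by
      intro S hS
      have t := tendsto_finsetSum s' fun l hl =>
        (tendsto_const_nhds (x := f l)).mul (tendsto_lead (u := u) A l (hle l hl) S)
      refine tendsto_nhds_unique t (tendsto_const_nhds.congr' ?_)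
      filter_upwards [eventually_gt_atTop (S.sup id)] with n hn
      have hnS : n ∉ S := fun h => absurd (le_sup (f := id) h) (not_le.2 hn)
      have h1 := h0 (insert n S) (by rw [card_insert_of_notMem hnS, hS])
      have h2 : ∑ l ∈ s', f l * wd xN u l (insert n S) = 0 := by
        rw [← h1]
        refine sum_subset (filter_subset _ _) fun l hl hl' => ?_
        have : f l = 0 := by
          by_contra hh
          exact hl' (mem_filter.2 ⟨hl, hh⟩)
        rw [this, zero_mul]
      simp only [← mul_div_assoc]
      rw [← sum_div, h2, zero_div]
    have hinj : Function.Injective (List.cons A) := fun a b h => (List.cons.inj h).2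
    have hμ : ∀ t : List ℤ, ∃ μ : ℝ, 0 < μ ∧ ((A :: t).Pairwise (· ≥ ·) →
        ∀ S, lead u A (A :: t) S = μ * wd xN u t S) := by
      intro t
      by_cases ht : (A :: t).Pairwise (· ≥ ·)
      · obtain ⟨μ, h1, h2⟩ := lead_cons hu A t ht
        exact ⟨μ, h1, fun _ => h2⟩
      · exact ⟨1, one_pos, fun h => absurd h ht⟩
    choose μ hμ1 hμ2 using hμ
    have := ih (s'.preimage (List.cons A) hinj.injOn) (fun t => f (A :: t) * μ t) ?_ ?_ tm
      (mem_preimage.2 hlm)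
    · exact (mul_ne_zero (mem_filter.1 hlm).2 (hμ1 tm).ne') this
    · intro t ht
      have := hs _ (mem_filter.1 (mem_preimage.1 ht)).1
      exact ⟨(List.pairwise_cons.1 this.1).2, by simpa using this.2⟩
    · intro S hS
      rw [← key S hS, ← sum_preimage (List.cons A) s' hinj.injOn]
      · refine sum_congr rfl fun t ht => ?_
        rw [hμ2 t (hs _ (mem_filter.1 (mem_preimage.1 ht)).1).1, mul_assoc]
      · intro l hl hl'
        have h1 := hs l (mem_filter.1 hl).1
        obtain ⟨a, t, rfl⟩ := List.exists_cons_of_length_eq_add_one h1.2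
        have hlt : a < A := lt_of_le_of_ne (hle _ hl a (by simp)) fun e => hl' ⟨t, by rw [e]⟩
        rw [lead_lt, mul_zero]
        intro z hz
        rcases List.mem_cons.1 hz with rfl | hz
        · exact hlt
        · exact lt_of_le_of_lt ((List.pairwise_cons.1 h1.1).1 z hz) hlt

end Independence

end QuantumQ

end

noncomputable section

namespace QuantumQ

open Finset

/-! ### Faithfulness of the shuffle realization -/

/-- A positive transcendental number. -/
def tr : ℝ := liouvilleNumber 2 ^ 2

lemma transcendental_tr : Transcendental ℤ tr :=
  (transcendental_liouvilleNumber le_rfl).pow two_pos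

lemma tr_ne_zero : tr ≠ 0 := fun h => transcendental_tr (h ▸ isAlgebraic_zero)

lemma tr_pos : 0 < tr := lt_of_le_of_ne (sq_nonneg _) tr_ne_zero.symm

/-- The evaluation of Laurent polynomials at the number `tr`. -/
instance algebraZqReal : Algebra Zq ℝ :=
  (LaurentPolynomial.eval₂ (Int.castRingHom ℝ) (Units.mk0 tr tr_ne_zero)).toAlgebra

lemma algebraMap_T (n : ℤ) : algebraMap Zq ℝ (LaurentPolynomial.T n) = tr ^ n := by
  rw [RingHom.algebraMap_toAlgebra, LaurentPolynomial.eval₂_T, Units.val_zpow_eq_zpow_val,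
    Units.val_mk0]

lemma algebraMap_q : algebraMap Zq ℝ q = tr := (algebraMap_T 1).trans (zpow_one _)

lemma algebraMap_Zq_injective : Function.Injective (algebraMap Zq ℝ) := by
  rw [injective_iff_map_eq_zero]
  intro f
  induction f using LaurentPolynomial.induction_on_mul_T with
  | mul_T p n =>
    intro h
    rw [map_mul, algebraMap_T, mul_eq_zero, or_iff_left (zpow_ne_zero _ tr_ne_zero),
      RingHom.algebraMap_toAlgebra, LaurentPolynomial.eval₂_toLaurent, Units.val_mk0] at h
    have hp : p = 0 := transcendental_iff.1 transcendental_tr p h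
    rw [hp, map_zero, zero_mul]

lemma xN_ne_mul_xN {t : ℝ} (ht : Transcendental ℤ t) (i j : ℕ) : xN i ≠ t * xN j := by
  intro h
  unfold xN at h
  have := transcendental_iff.1 ht (Polynomial.C (j + 1 : ℤ) * Polynomial.X - Polynomial.C (i + 1 : ℤ))
    (by simp; linarith)
  have h1 := congrArg (fun p => Polynomial.coeff p 1) this
  simp only [Polynomial.coeff_sub, Polynomial.coeff_C_mul_X, Polynomial.coeff_C,
    Polynomial.coeff_zero] at h1
  simp at h1
  omega

lemma generic_xN : Generic xN (algebraMap Zq ℝ q) where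
  ne_zero i := (xN_pos i).ne'
  u_ne_zero := by rw [algebraMap_q]; exact tr_ne_zero
  inj _ _ h := xN_inj h
  ne_u i j := by rw [algebraMap_q]; exact xN_ne_mul_xN transcendental_tr i j
  ne_u_sq i j := by
    rw [algebraMap_q, ← mul_assoc, ← sq]
    exact xN_ne_mul_xN (transcendental_tr.pow two_pos) i j

/-- The shuffle realization in the variables `1, 2, 3, …` over the real numbers. -/
abbrev realShuffle : CurAlg →ₐ[Zq] Module.End ℝ (Finset ℕ → ℝ) := shuffle xN generic_xN

lemma realShuffle_cw (l : List ℤ) : realShuffle (cw l) = T xN tr (wd xN tr l) := by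
  rw [cw, ← T_wd, map_list_prod, List.map_map]
  congr 2
  funext a
  rw [Function.comp_apply, shuffle_e, algebraMap_q]

/-- Expand in decreasing words and apply the operator to `vac`. The lengths separate by the
cardinality of `S`, and independence over the reals descends to `ℤ[q, q⁻¹]` because `q` acts as a
transcendental number. -/
theorem realShuffle_injective : Function.Injective realShuffle := by
  rw [injective_iff_map_eq_zero]
  intro y hy
  obtain ⟨c, hc, rfl⟩ := (Finsupp.mem_span_image_iff_linearCombination Zq).1 (mem_span_cw y)
  rw [Finsupp.mem_supported] at hc
  have h1 : ∀ S : Finset ℕ, ∑ l ∈ c.support, algebraMap Zq ℝ (c l) * wd xN tr l S = 0 := by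
    intro S
    have h2 := congrArg (fun F : Module.End ℝ (Finset ℕ → ℝ) => F vac S) hy
    have h3 : ∀ l, (c l • T xN tr (wd xN tr l)) vac S = algebraMap Zq ℝ (c l) * wd xN tr l S := by
      intro l
      have := smul_T (x := xN) (c l) (wd xN tr l)
      rw [algebraMap_q] at this
      rw [this, T_apply, star_vac, Pi.smul_apply, smul_eq_mul]
    have h5 : (realShuffle (Finsupp.linearCombination Zq cw c)) vac S = 0 := h2
    rw [← h5]
    simp only [Finsupp.linearCombination_apply, Finsupp.sum, map_sum, map_smul, realShuffle_cw]
    rw [LinearMap.sum_apply, Finset.sum_apply]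
    exact sum_congr rfl fun l _ => (h3 l).symm
  suffices c = 0 by rw [this, map_zero]
  ext1 l
  by_contra hl
  rw [Finsupp.zero_apply] at hl
  have h4 := wd_independent tr_pos l.length (c.support.filter fun l' => l'.length = l.length)
    (fun l => algebraMap Zq ℝ (c l))
    (fun l' hl' => ⟨hc (mem_filter.1 hl').1, (mem_filter.1 hl').2⟩)
    (fun S hS => by
      rw [← h1 S]
      refine sum_subset (filter_subset _ _) fun l' h5 h6 => ?_
      rw [wd_card, mul_zero]
      exact fun h7 => h6 (mem_filter.2 ⟨h5, h7.symm.trans hS⟩))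
    l (mem_filter.2 ⟨Finsupp.mem_support_iff.2 hl, rfl⟩)
  exact hl (algebraMap_Zq_injective (h4.trans (map_zero _).symm))

end QuantumQ

end

noncomputable section

namespace QuantumQ

open Finset

/-! ### Quantum determinants satisfy the `M`-system -/

lemma map_sq_sub_mul {A B : Type} [Ring A] [Algebra Zq A] [Ring B] [Algebra Zq B] (f : A →ₐ[Zq] B)
    (x y z : A) : f (x ^ 2 - y * z) = f x * f x - f y * f z := by
  rw [map_sub, map_pow, map_mul, sq]

lemma CurAlg.qDet_msys (α : ℕ) (n : ℤ) :
    q ^ (α + 1) • (qDet CurAlg.e (α + 1) (n + 1) * qDet CurAlg.e (α + 1) (n - 1)) =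
      qDet CurAlg.e (α + 1) n ^ 2 - qDet CurAlg.e (α + 2) n * qDet CurAlg.e α n := by
  apply realShuffle_injective
  refine Eq.trans ?_ (map_sq_sub_mul realShuffle (qDet CurAlg.e (α + 1) n)
    (qDet CurAlg.e (α + 2) n) (qDet CurAlg.e α n)).symm
  rw [map_smul, map_mul]
  simp only [shuffle_qDet, T_mul]
  rw [smul_T, map_pow, star_msys generic_xN, ← Tl_apply, map_sub]
  rfl

lemma CurAlg.qDet_comm (α β ε : ℕ) (n : ℤ) (hε : ε ≤ 1) :
    qDet CurAlg.e α n * qDet CurAlg.e β (n + ε) =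
      q ^ (min α β * ε) • (qDet CurAlg.e β (n + ε) * qDet CurAlg.e α n) := by
  apply realShuffle_injective
  rw [map_smul, map_mul, map_mul]
  simp only [shuffle_qDet, T_mul]
  rw [smul_T, map_pow]
  interval_cases ε
  · simp only [Nat.cast_zero, add_zero, mul_zero, pow_zero, one_smul]
    rw [star_same generic_xN]
  · rw [mul_one, Nat.cast_one, star_next generic_xN]

section

variable {A : Type} [Ring A] [Algebra Zq A] {m : ℤ → A}

/-- The homomorphism from the current algebra given by a family satisfying the exchange relation. -/
def CurAlg.lift (m : ℤ → A) (h1 : ∀ a b, a ≠ b → exch m a b = 0)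
    (h2 : ∀ a, qComm (m (a - 1)) (m a) = 0) : CurAlg →ₐ[Zq] A :=
  RingQuot.liftAlgHom Zq ⟨FreeAlgebra.lift Zq m, by
    rintro _ _ (⟨a, b, h⟩ | ⟨a⟩)
    · simp only [qComm, map_add, map_sub, map_mul, map_smul, FreeAlgebra.lift_ι_apply, map_zero]
      exact h1 a b h
    · simp only [qComm, map_sub, map_mul, map_smul, FreeAlgebra.lift_ι_apply, map_zero]
      exact h2 a⟩

lemma CurAlg.lift_e (h1 : ∀ a b, a ≠ b → exch m a b = 0) (h2 : ∀ a, qComm (m (a - 1)) (m a) = 0)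
    (n : ℤ) : CurAlg.lift m h1 h2 (CurAlg.e n) = m n := by
  rw [CurAlg.lift, CurAlg.e, RingQuot.liftAlgHom_mkAlgHom_apply, FreeAlgebra.lift_ι_apply]

lemma CurAlg.lift_qDet (h1 : ∀ a b, a ≠ b → exch m a b = 0)
    (h2 : ∀ a, qComm (m (a - 1)) (m a) = 0) (α : ℕ) (n : ℤ) :
    CurAlg.lift m h1 h2 (qDet CurAlg.e α n) = qDet m α n := by
  refine (map_qDet _ CurAlg.e α n).trans ?_
  simp only [CurAlg.lift_e]

/-- The current algebra is universal for families obeying the exchange relation, so its identity is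
transported along `CurAlg.lift`. -/
lemma qDet_msys (h1 : ∀ a b, a ≠ b → exch m a b = 0) (h2 : ∀ a, qComm (m (a - 1)) (m a) = 0)
    (α : ℕ) (n : ℤ) : q ^ (α + 1) • (qDet m (α + 1) (n + 1) * qDet m (α + 1) (n - 1)) =
      qDet m (α + 1) n ^ 2 - qDet m (α + 2) n * qDet m α n := by
  have := (congrArg (CurAlg.lift m h1 h2) (CurAlg.qDet_msys α n)).trans
    (map_sq_sub_mul (CurAlg.lift m h1 h2) (qDet CurAlg.e (α + 1) n) (qDet CurAlg.e (α + 2) n)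
      (qDet CurAlg.e α n))
  rw [map_smul, map_mul] at this
  simp only [CurAlg.lift_qDet] at this
  rw [this, sq]

lemma qDet_comm (h1 : ∀ a b, a ≠ b → exch m a b = 0) (h2 : ∀ a, qComm (m (a - 1)) (m a) = 0)
    (α β ε : ℕ) (n : ℤ) (hε : ε ≤ 1) : qDet m α n * qDet m β (n + ε) =
      q ^ (min α β * ε) • (qDet m β (n + ε) * qDet m α n) := by
  have := congrArg (CurAlg.lift m h1 h2) (CurAlg.qDet_comm α β ε n hε)
  rw [map_smul, map_mul, map_mul] at this
  simpa only [CurAlg.lift_qDet] using this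

lemma qDet_of_qVandermonde_eq_one {α : ℕ} (h : qVandermonde α = 1) (n : ℤ) :
    qDet m α n = (List.ofFn fun _ : Fin α => m n).prod := by
  rw [qDet, h, AddMonoidAlgebra.one_def]
  refine (Finsupp.sum_single_index (by simp)).trans ?_
  simp

lemma qDet_zero (n : ℤ) : qDet m 0 n = 1 := by
  rw [qDet_of_qVandermonde_eq_one]
  · simp
  · rw [qVandermonde]
    exact prod_of_isEmpty _

lemma qDet_one (n : ℤ) : qDet m 1 n = m n := by
  rw [qDet_of_qVandermonde_eq_one]
  · simp
  · rw [qVandermonde, filter_false_of_mem, prod_empty]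
    intro p _
    rw [Subsingleton.elim p.1 p.2]
    exact lt_irrefl _

lemma IsMSystem.qComm_eq_zero {N : ℕ} {M : ℕ → ℤ → A} (h : IsMSystem N M) (hN : 1 ≤ N) (a : ℤ) :
    qComm (M 1 (a - 1)) (M 1 a) = 0 := by
  have := h.comm 1 1 1 (a - 1) le_rfl hN le_rfl hN le_rfl
  rw [Nat.cast_one, sub_add_cancel, min_self, mul_one, pow_one] at this
  rw [qComm, this, sub_self]

/-- A solution of the `M`-system is given by quantum determinants. -/
theorem IsMSystem.eq_qDet {N : ℕ} {M D : ℕ → ℤ → A} (h : IsMSystem N M) (hD : IsInverse N M D)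
    (hN : 2 ≤ N) : ∀ α ≤ N + 1, ∀ n, M α n = qDet (M 1) α n := by
  have h1 : ∀ a b, a ≠ b → exch (M 1) a b = 0 := fun a b _ => h.exch_eq_zero hD hN a b
  have h2 := h.qComm_eq_zero (by omega)
  intro α
  induction α using Nat.strong_induction_on with
  | _ α ih =>
    intro hα n
    rcases α with _ | _ | α
    · rw [h.zero, qDet_zero]
    · rw [zero_add, qDet_one]
    -- The given solution and the quantum determinants agree on levels `α` and `α + 1`, so the
    -- M-system equates `M (α + 2) n * M α n` with its determinant analogue; `M α n` is then
    -- cancelled.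
    · have e1 := h.msys (α + 1) n (by omega) (by omega)
      have e2 := qDet_msys h1 h2 α n
      rw [← ih (α + 1) (by omega) (by omega), ← ih (α + 1) (by omega) (by omega),
        ← ih (α + 1) (by omega) (by omega), ← ih α (by omega) (by omega), e1,
        sub_right_inj] at e2
      rw [Nat.add_sub_cancel] at e2
      have e3 := congrArg (· * D α n) e2
      simp only [mul_assoc, (hD α n (by omega)).1, mul_one] at e3
      exact e3

end

end QuantumQ

end

/-! ### Universal properties and assembly of the isomorphisms -/

noncomputable section

namespace QuantumQ

open Finset

/-! ### The universal property of the localization -/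

namespace Loc

variable {R : Type} [CommRing R] {A B ι : Type} [Ring A] [Algebra R A] [Ring B] [Algebra R B]
  {s : ι → A}

variable (R s) in
/-- The adjoined inverse of `s i`. -/
def inv (i : ι) : Loc R s := RingQuot.mkAlgHom R (LocRel R s) (FreeAlgebra.ι R (Sum.inr i))

lemma of_apply (a : A) :
    Loc.of R s a = RingQuot.mkAlgHom R (LocRel R s) (FreeAlgebra.ι R (Sum.inl a)) := rfl

lemma of_mul_inv (i : ι) : Loc.of R s (s i) * inv R s i = 1 := by
  have := RingQuot.mkAlgHom_rel R (LocRel.mul_inv (R := R) (s := s) i)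
  rwa [map_mul, map_one] at this

lemma inv_mul_of (i : ι) : inv R s i * Loc.of R s (s i) = 1 := by
  have := RingQuot.mkAlgHom_rel R (LocRel.inv_mul (R := R) (s := s) i)
  rwa [map_mul, map_one] at this

/-- The universal property of the localization. -/
def lift (f : A →ₐ[R] B) (t : ι → B) (h1 : ∀ i, f (s i) * t i = 1) (h2 : ∀ i, t i * f (s i) = 1) :
    Loc R s →ₐ[R] B :=
  RingQuot.liftAlgHom R ⟨FreeAlgebra.lift R (Sum.elim f t), by
    rintro _ _ (⟨x, y⟩ | ⟨x, y⟩ | ⟨c⟩ | ⟨i⟩ | ⟨i⟩)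
    · simp only [map_add, FreeAlgebra.lift_ι_apply, Sum.elim_inl]
    · simp only [map_mul, FreeAlgebra.lift_ι_apply, Sum.elim_inl]
    · simp only [FreeAlgebra.lift_ι_apply, Sum.elim_inl, AlgHom.commutes]
    · simp only [map_mul, FreeAlgebra.lift_ι_apply, Sum.elim_inl, Sum.elim_inr, map_one, h1]
    · simp only [map_mul, FreeAlgebra.lift_ι_apply, Sum.elim_inl, Sum.elim_inr, map_one, h2]⟩

lemma lift_of (f : A →ₐ[R] B) (t : ι → B) (h1 : ∀ i, f (s i) * t i = 1)
    (h2 : ∀ i, t i * f (s i) = 1) (a : A) : lift f t h1 h2 (Loc.of R s a) = f a := by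
  rw [lift, of_apply, RingQuot.liftAlgHom_mkAlgHom_apply, FreeAlgebra.lift_ι_apply, Sum.elim_inl]

/-- Two-sided inverses are unique, so agreement on `A` forces agreement on the adjoined inverses. -/
lemma hom_ext {f g : Loc R s →ₐ[R] B} (h : ∀ a, f (Loc.of R s a) = g (Loc.of R s a)) : f = g := by
  apply RingQuot.ringQuot_ext'
  apply FreeAlgebra.hom_ext
  funext z
  rcases z with a | i
  · exact h a
  · have e : ∀ k : Loc R s →ₐ[R] B, k (inv R s i) * k (Loc.of R s (s i)) = 1 ∧
        k (Loc.of R s (s i)) * k (inv R s i) = 1 := fun k => by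
      rw [← map_mul, ← map_mul, of_mul_inv, inv_mul_of, map_one]
      exact ⟨rfl, rfl⟩
    have e1 := (e g).2
    rw [← h] at e1
    exact left_inv_eq_right_inv (e f).1 e1

/-- A surjective homomorphism matching two families becomes an isomorphism of localizations as
soon as the localization map of the source factors through it. -/
def equivOfFactor {s' : ι → B} (f : A →ₐ[R] B) (hs : ∀ i, f (s i) = s' i)
    (hf : Function.Surjective f) (g : B →ₐ[R] Loc R s) (hg : ∀ a, g (f a) = Loc.of R s a) :
    Loc R s ≃ₐ[R] Loc R s' :=
  AlgEquiv.ofAlgHom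
    (lift ((Loc.of R s').comp f) (inv R s')
      (fun i => by rw [AlgHom.comp_apply, hs, of_mul_inv])
      (fun i => by rw [AlgHom.comp_apply, hs, inv_mul_of]))
    (lift g (inv R s) (fun i => by rw [← hs, hg, of_mul_inv])
      (fun i => by rw [← hs, hg, inv_mul_of]))
    (hom_ext fun b => by
      obtain ⟨a, rfl⟩ := hf b
      rw [AlgHom.comp_apply, lift_of, hg, lift_of]
      rfl)
    (hom_ext fun a => by
      rw [AlgHom.comp_apply, lift_of, AlgHom.comp_apply, lift_of, hg]
      rfl)

lemma exists_equiv_of_factor {s' : ι → B} (f : A →ₐ[R] B) (hs : ∀ i, f (s i) = s' i)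
    (hf : Function.Surjective f) (g : B →ₐ[R] Loc R s) (hg : ∀ a, g (f a) = Loc.of R s a) :
    ∃ Φ : Loc R s ≃ₐ[R] Loc R s', ∀ a, Φ (Loc.of R s a) = Loc.of R s' (f a) :=
  ⟨equivOfFactor f hs hf g hg, fun a => lift_of _ _ _ _ a⟩

lemma exists_equiv_of_equiv {s' : ι → B} (e : A ≃ₐ[R] B) (hs : ∀ i, e (s i) = s' i) :
    ∃ Φ : Loc R s ≃ₐ[R] Loc R s', ∀ a, Φ (Loc.of R s a) = Loc.of R s' (e a) :=
  exists_equiv_of_factor (e : A →ₐ[R] B) hs e.surjective ((Loc.of R s).comp (e.symm : B →ₐ[R] A))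
    fun a => congrArg (Loc.of R s) (e.symm_apply_apply a)

end Loc

/-! ### The algebra of the exchange relation and the rank condition -/

section Lift

variable {A : Type} [Ring A] [Algebra Zq A] {r : ℕ}

lemma ExAlg.exch_eq_zero (a b : ℤ) (h : a ≠ b) : exch (ExAlg.m r) a b = 0 := by
  have := RingQuot.mkAlgHom_rel Zq (ExchangeRankRel.exchange (r := r) (ExchangeRel.offDiag a b h))
  simp only [qComm, map_add, map_sub, map_mul, map_smul, map_zero] at this
  exact this

lemma ExAlg.qComm_eq_zero (a : ℤ) : qComm (ExAlg.m r (a - 1)) (ExAlg.m r a) = 0 := by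
  have := RingQuot.mkAlgHom_rel Zq (ExchangeRankRel.exchange (r := r) (ExchangeRel.diag a))
  simp only [qComm, map_sub, map_mul, map_smul, map_zero] at this
  exact this

lemma ExAlg.rank (n : ℤ) : qDet (ExAlg.m r) (r + 2) n = 0 := by
  have := RingQuot.mkAlgHom_rel Zq (ExchangeRankRel.rank (r := r) n)
  have e := map_qDet (A := FreeAlgebra Zq ℤ) (B := ExAlg r)
    (RingQuot.mkAlgHom Zq (ExchangeRankRel r)) (FreeAlgebra.ι Zq) (r + 2) n
  exact e.symm.trans (this.trans (map_zero _))

/-- The homomorphism given by a family satisfying the exchange relation and the rank condition. -/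
def ExAlg.lift (m : ℤ → A) (h1 : ∀ a b, a ≠ b → exch m a b = 0)
    (h2 : ∀ a, qComm (m (a - 1)) (m a) = 0) (h3 : ∀ n, qDet m (r + 2) n = 0) : ExAlg r →ₐ[Zq] A :=
  RingQuot.liftAlgHom Zq ⟨FreeAlgebra.lift Zq m, by
    rintro _ _ (⟨⟨a, b, h⟩ | ⟨a⟩⟩ | ⟨n⟩)
    · simp only [qComm, map_add, map_sub, map_mul, map_smul, FreeAlgebra.lift_ι_apply, map_zero]
      exact h1 a b h
    · simp only [qComm, map_sub, map_mul, map_smul, FreeAlgebra.lift_ι_apply, map_zero]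
      exact h2 a
    · rw [map_qDet, map_zero]
      simp only [FreeAlgebra.lift_ι_apply]
      exact h3 n⟩

lemma ExAlg.lift_m (m : ℤ → A) (h1 : ∀ a b, a ≠ b → exch m a b = 0)
    (h2 : ∀ a, qComm (m (a - 1)) (m a) = 0) (h3 : ∀ n, qDet m (r + 2) n = 0) (n : ℤ) :
    ExAlg.lift m h1 h2 h3 (ExAlg.m r n) = m n := by
  rw [ExAlg.lift, ExAlg.m, RingQuot.liftAlgHom_mkAlgHom_apply, FreeAlgebra.lift_ι_apply]

lemma ExAlg.hom_ext {f g : ExAlg r →ₐ[Zq] A} (h : ∀ n, f (ExAlg.m r n) = g (ExAlg.m r n)) :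
    f = g := by
  apply RingQuot.ringQuot_ext'
  apply FreeAlgebra.hom_ext
  funext n
  exact h n

lemma CurAlg.hom_ext {f g : CurAlg →ₐ[Zq] A} (h : ∀ n, f (CurAlg.e n) = g (CurAlg.e n)) :
    f = g := by
  apply RingQuot.ringQuot_ext'
  apply FreeAlgebra.hom_ext
  funext n
  exact h n

lemma map_exch {B : Type} [Ring B] [Algebra Zq B] (f : A →ₐ[Zq] B) (m : ℤ → A) (a b : ℤ) :
    f (exch m a b) = exch (fun k => f (m k)) a b := by
  simp only [exch, qComm, map_add, map_sub, map_mul, map_smul]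

lemma map_qComm {B : Type} [Ring B] [Algebra Zq B] (f : A →ₐ[Zq] B) (x y : A) :
    f (qComm x y) = qComm (f x) (f y) := by
  simp only [qComm, map_sub, map_mul, map_smul]

lemma span_ringCon_le_ker {B : Type} [Ring B] [Algebra Zq B] (f : A →ₐ[Zq] B) {S : Set A}
    (h : ∀ x ∈ S, f x = 0) : (TwoSidedIdeal.span S).ringCon ≤ RingCon.ker f.toRingHom := by
  have : TwoSidedIdeal.span S ≤ TwoSidedIdeal.ker f :=
    TwoSidedIdeal.span_le.2 fun x hx => (TwoSidedIdeal.mem_ker f).2 (h x hx)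
  exact TwoSidedIdeal.ringCon_le_iff.1 this

/-! ### The quotient of the current algebra -/

variable (r) in
/-- The quotient map. -/
def CurQuot.mk : CurAlg →ₐ[Zq] CurQuot r := (rankIdeal r).ringCon.mkₐ Zq

variable (r) in
/-- The homomorphism from the quotient of the current algebra to `ExAlg r`. -/
def CurQuot.toExAlg : CurQuot r →ₐ[Zq] ExAlg r :=
  (rankIdeal r).ringCon.liftₐ (CurAlg.lift (ExAlg.m r) ExAlg.exch_eq_zero ExAlg.qComm_eq_zero) (by
    refine span_ringCon_le_ker (A := CurAlg) (B := ExAlg r)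
      (CurAlg.lift (ExAlg.m r) ExAlg.exch_eq_zero ExAlg.qComm_eq_zero) ?_
    rintro _ ⟨n, rfl⟩
    exact (CurAlg.lift_qDet _ _ _ _).trans (ExAlg.rank n))

lemma CurQuot.toExAlg_mk (x : CurAlg) : CurQuot.toExAlg r (CurQuot.mk r x) =
    CurAlg.lift (ExAlg.m r) ExAlg.exch_eq_zero ExAlg.qComm_eq_zero x := rfl

lemma CurQuot.mk_e (n : ℤ) : CurQuot.mk r (CurAlg.e n) = CurQuot.e r n := rfl

variable (r) in
/-- The homomorphism from `ExAlg r` to the quotient of the current algebra. -/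
def ExAlg.toCurQuot : ExAlg r →ₐ[Zq] CurQuot r :=
  ExAlg.lift (CurQuot.e r)
    (fun a b h => (map_exch (CurQuot.mk r) CurAlg.e a b).symm.trans
      ((congrArg _ (CurAlg.exch_eq_zero h)).trans (map_zero _)))
    (fun a => (map_qComm (CurQuot.mk r) (CurAlg.e (a - 1)) (CurAlg.e a)).symm.trans
      ((congrArg _ (CurAlg.qComm_eq_zero a)).trans (map_zero _)))
    (fun n => (map_qDet (CurQuot.mk r) CurAlg.e (r + 2) n).symm.trans
      ((rankIdeal r).ringCon.eq.2 (TwoSidedIdeal.subset_span ⟨n, rfl⟩)))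

lemma ExAlg.toCurQuot_m (n : ℤ) : ExAlg.toCurQuot r (ExAlg.m r n) = CurQuot.e r n :=
  ExAlg.lift_m _ _ _ _ _

variable (r) in
/-- The two presentations of the algebra of the exchange relation and the rank condition. -/
def exAlgEquiv : ExAlg r ≃ₐ[Zq] CurQuot r :=
  AlgEquiv.ofAlgHom (ExAlg.toCurQuot r) (CurQuot.toExAlg r)
    (by
      have : ((ExAlg.toCurQuot r).comp (CurQuot.toExAlg r)).comp (CurQuot.mk r) =
          (AlgHom.id Zq (CurQuot r)).comp (CurQuot.mk r) := CurAlg.hom_ext fun n => by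
        rw [AlgHom.comp_apply, AlgHom.comp_apply, CurQuot.toExAlg_mk, CurAlg.lift_e,
          ExAlg.toCurQuot_m]
        rfl
      exact RingCon.Quotient.hom_extₐ this)
    (ExAlg.hom_ext (A := ExAlg r) (f := (CurQuot.toExAlg r).comp (ExAlg.toCurQuot r))
      (g := AlgHom.id Zq (ExAlg r)) fun n => by
      rw [AlgHom.comp_apply, ExAlg.toCurQuot_m, ← CurQuot.mk_e, CurQuot.toExAlg_mk, CurAlg.lift_e]
      rfl)

lemma exAlgEquiv_m (n : ℤ) : exAlgEquiv r (ExAlg.m r n) = CurQuot.e r n := ExAlg.toCurQuot_m n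

/-! ### The homomorphism from the algebra of the `M`-system -/

lemma MAlg.M_zero (n : ℤ) : MAlg.M r 0 n = 1 := by
  rw [MAlg.M, freeM, dif_neg (by simp), map_one]

variable (r) in
/-- The homomorphism from the free algebra sending `M_{α,n}` to the quantum determinant. -/
def freeMLift (m : ℤ → A) : FreeAlgebra Zq (Set.Icc 1 (r + 2) × ℤ) →ₐ[Zq] A :=
  FreeAlgebra.lift Zq fun p => qDet m p.1 p.2

lemma freeMLift_freeM (m : ℤ → A) (α : ℕ) (hα : α ≤ r + 2) (n : ℤ) :
    freeMLift r m (freeM r α n) = qDet m α n := by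
  rw [freeM]
  split_ifs with h
  · rw [freeMLift, FreeAlgebra.lift_ι_apply]
  · have : α = 0 := by
      by_contra h0
      exact h ⟨by omega, hα⟩
    rw [this, map_one, qDet_zero]

/-- The homomorphism sending `M_{α,n}` to the quantum determinant of a family satisfying the
exchange relation and the rank condition. -/
def MAlg.lift (m : ℤ → A) (h1 : ∀ a b, a ≠ b → exch m a b = 0)
    (h2 : ∀ a, qComm (m (a - 1)) (m a) = 0) (h3 : ∀ n, qDet m (r + 2) n = 0) : MAlg r →ₐ[Zq] A :=
  RingQuot.liftAlgHom Zq ⟨freeMLift r m, by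
    rintro _ _ (⟨α, n, hα1, hα2⟩ | ⟨α, β, ε, n, hα1, hα2, hβ1, hβ2, hε⟩ | ⟨n⟩)
    · obtain ⟨α, rfl⟩ := Nat.exists_eq_add_of_le' hα1
      rw [map_smul, map_sub, map_mul, map_mul, map_pow, freeMLift_freeM _ _ (by omega),
        freeMLift_freeM _ _ (by omega), freeMLift_freeM _ _ (by omega),
        freeMLift_freeM _ _ (by omega), freeMLift_freeM _ _ (by omega), Nat.add_sub_cancel]
      exact qDet_msys h1 h2 α n
    · rw [map_smul, map_mul, map_mul, freeMLift_freeM _ _ (by omega),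
        freeMLift_freeM _ _ (by omega)]
      exact qDet_comm h1 h2 α β ε n hε
    · rw [freeMLift_freeM _ _ le_rfl, map_zero]
      exact h3 n⟩

lemma MAlg.lift_M (m : ℤ → A) (h1 : ∀ a b, a ≠ b → exch m a b = 0)
    (h2 : ∀ a, qComm (m (a - 1)) (m a) = 0) (h3 : ∀ n, qDet m (r + 2) n = 0) (α : ℕ)
    (hα : α ≤ r + 2) (n : ℤ) : MAlg.lift m h1 h2 h3 (MAlg.M r α n) = qDet m α n := by
  rw [MAlg.lift, MAlg.M, RingQuot.liftAlgHom_mkAlgHom_apply, freeMLift_freeM _ _ hα]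

variable (r) in
/-- The homomorphism to `ExAlg r` sending `M_{α,n}` to the quantum determinant. -/
def MAlg.toExAlg : MAlg r →ₐ[Zq] ExAlg r :=
  MAlg.lift (ExAlg.m r) ExAlg.exch_eq_zero ExAlg.qComm_eq_zero ExAlg.rank

lemma MAlg.toExAlg_M (α : ℕ) (hα : α ≤ r + 2) (n : ℤ) :
    MAlg.toExAlg r (MAlg.M r α n) = qDet (ExAlg.m r) α n :=
  MAlg.lift_M _ _ _ _ α hα n

lemma MAlg.toExAlg_M_one (n : ℤ) : MAlg.toExAlg r (MAlg.M r 1 n) = ExAlg.m r n := by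
  rw [MAlg.toExAlg_M _ (by omega), qDet_one]

lemma MAlg.toExAlg_surjective : Function.Surjective (MAlg.toExAlg r) := by
  intro y
  obtain ⟨z, rfl⟩ := RingQuot.mkAlgHom_surjective Zq (ExchangeRankRel r) y
  refine ⟨FreeAlgebra.lift Zq (MAlg.M r 1) z, ?_⟩
  have : (MAlg.toExAlg r).comp (FreeAlgebra.lift Zq (MAlg.M r 1)) =
      RingQuot.mkAlgHom Zq (ExchangeRankRel r) := by
    apply FreeAlgebra.hom_ext
    funext n
    exact (congrArg _ (FreeAlgebra.lift_ι_apply _ _)).trans (MAlg.toExAlg_M_one n)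
  exact AlgHom.congr_fun this z

lemma MAlg.hom_ext {f g : MAlg r →ₐ[Zq] A}
    (h : ∀ α n, α ≤ r + 2 → f (MAlg.M r α n) = g (MAlg.M r α n)) : f = g := by
  apply RingQuot.ringQuot_ext'
  apply FreeAlgebra.hom_ext
  funext p
  have := h p.1 p.2 p.1.2.2
  simp only [MAlg.M, freeM, dif_pos p.1.2] at this
  exact this

lemma MAlg.isMSystem (f : MAlg r →ₐ[Zq] A) : IsMSystem (r + 1) fun α n => f (MAlg.M r α n) where
  zero n := by rw [MAlg.M_zero, map_one]
  msys α n h1 h2 := by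
    have := congrArg f (RingQuot.mkAlgHom_rel Zq (MRel.msys α n h1 h2))
    simp only [map_smul, map_sub, map_mul, map_pow] at this
    exact this
  comm α β ε n h1 h2 h3 h4 h5 := by
    have := congrArg f (RingQuot.mkAlgHom_rel Zq (MRel.comm α β ε n h1 h2 h3 h4 h5))
    simp only [map_smul, map_mul] at this
    exact this
  top n := by
    have := congrArg f (RingQuot.mkAlgHom_rel Zq (MRel.rank (r := r) n))
    rwa [map_zero, map_zero] at this

/-- The homomorphism from `ExAlg r` to an algebra in which the images of the `M_{α,n}` are
invertible. -/
def ExAlg.ofInverse (hr : 1 ≤ r) (f : MAlg r →ₐ[Zq] A) {D : ℕ → ℤ → A}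
    (hD : IsInverse (r + 1) (fun α n => f (MAlg.M r α n)) D) : ExAlg r →ₐ[Zq] A :=
  ExAlg.lift (fun n => f (MAlg.M r 1 n))
    (fun a b _ => (MAlg.isMSystem f).exch_eq_zero hD (by omega) a b)
    (fun a => (MAlg.isMSystem f).qComm_eq_zero (by omega) a)
    (fun n => ((MAlg.isMSystem f).eq_qDet hD (by omega) _ le_rfl n).symm.trans
      ((MAlg.isMSystem f).top n))

lemma ExAlg.ofInverse_toExAlg (hr : 1 ≤ r) (f : MAlg r →ₐ[Zq] A) {D : ℕ → ℤ → A}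
    (hD : IsInverse (r + 1) (fun α n => f (MAlg.M r α n)) D) (a : MAlg r) :
    ExAlg.ofInverse hr f hD (MAlg.toExAlg r a) = f a := by
  have : (ExAlg.ofInverse hr f hD).comp (MAlg.toExAlg r) = f :=
    MAlg.hom_ext fun α n hα => by
      rw [AlgHom.comp_apply, MAlg.toExAlg_M α hα]
      refine (map_qDet (ExAlg.ofInverse hr f hD) (ExAlg.m r) α n).trans (Eq.trans ?_
        ((MAlg.isMSystem f).eq_qDet hD (by omega) α hα n).symm)
      exact congrArg (fun m => qDet m α n) (funext fun k => ExAlg.lift_m _ _ _ _ k)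
  exact AlgHom.congr_fun this a

lemma exists_isInverse (f : MAlg r →ₐ[Zq] A) (t : Idx r → A)
    (h1 : ∀ i, f (MAlg.fam r i) * t i = 1) (h2 : ∀ i, t i * f (MAlg.fam r i) = 1) :
    ∃ D, IsInverse (r + 1) (fun α n => f (MAlg.M r α n)) D := by
  -- The default 1 serves `α = 0`, where `M_{0,n} = 1`.
  refine ⟨fun α n => if h : α ∈ Set.Icc 1 (r + 1) then t (⟨α, h⟩, n) else 1, fun α n hα => ?_⟩
  beta_reduce
  split_ifs with h
  · exact ⟨h1 (⟨α, h⟩, n), h2 (⟨α, h⟩, n)⟩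
  · have : α = 0 := by
      by_contra h0
      exact h ⟨by omega, hα⟩
    simp only [this, MAlg.M_zero, map_one, mul_one, and_self]

/-- With `f` the localization map of `MAlg r`, this is the factorization that produces the inverse
isomorphism. -/
lemma exists_factor (hr : 1 ≤ r) (f : MAlg r →ₐ[Zq] A) (t : Idx r → A)
    (h1 : ∀ i, f (MAlg.fam r i) * t i = 1) (h2 : ∀ i, t i * f (MAlg.fam r i) = 1) :
    ∃ g : ExAlg r →ₐ[Zq] A, ∀ a, g (MAlg.toExAlg r a) = f a := by
  obtain ⟨D, hD⟩ := exists_isInverse f t h1 h2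
  exact ⟨ExAlg.ofInverse hr f hD, ExAlg.ofInverse_toExAlg hr f hD⟩

lemma MAlg.toExAlg_fam (i : Idx r) : MAlg.toExAlg r (MAlg.fam r i) = ExAlg.fam r i := by
  rw [MAlg.fam, ExAlg.fam, MAlg.toExAlg_M _ (i.1.2.2.trans (Nat.le_succ _))]

lemma exAlgEquiv_fam (i : Idx r) : exAlgEquiv r (ExAlg.fam r i) = CurQuot.fam r i := by
  have h := map_qDet (exAlgEquiv r : ExAlg r →ₐ[Zq] CurQuot r) (ExAlg.m r) i.1 i.2
  have e : (fun k => (exAlgEquiv r : ExAlg r →ₐ[Zq] CurQuot r) (ExAlg.m r k)) = CurQuot.e r :=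
    funext exAlgEquiv_m
  rw [e] at h
  exact h

/-- The homomorphism `MAlg.toExAlg` induces an isomorphism of localizations. -/
theorem exists_loc_equiv (hr : 1 ≤ r) :
    ∃ Φ : Loc Zq (MAlg.fam r) ≃ₐ[Zq] Loc Zq (ExAlg.fam r), ∀ x,
      Φ (Loc.of Zq (MAlg.fam r) x) = Loc.of Zq (ExAlg.fam r) (MAlg.toExAlg r x) := by
  obtain ⟨g, hg⟩ := exists_factor hr (Loc.of Zq (MAlg.fam r)) (Loc.inv Zq (MAlg.fam r))
    Loc.of_mul_inv Loc.inv_mul_of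
  exact Loc.exists_equiv_of_factor (R := Zq) (A := MAlg r) (B := ExAlg r) (s := MAlg.fam r)
    (s' := ExAlg.fam r) (MAlg.toExAlg r) MAlg.toExAlg_fam MAlg.toExAlg_surjective g hg

theorem exists_loc_exAlgEquiv :
    ∃ Θ : Loc Zq (ExAlg.fam r) ≃ₐ[Zq] Loc Zq (CurQuot.fam r), ∀ x,
      Θ (Loc.of Zq (ExAlg.fam r) x) = Loc.of Zq (CurQuot.fam r) (exAlgEquiv r x) :=
  Loc.exists_equiv_of_equiv (R := Zq) (A := ExAlg r) (B := CurQuot r) (s := ExAlg.fam r)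
    (s' := CurQuot.fam r) (exAlgEquiv r) exAlgEquiv_fam

end Lift

end QuantumQ

end

theorem mainTheorem1 (r : ℕ) (hr : 1 ≤ r) :
    ∃ (π : QuantumQ.MAlg r →ₐ[QuantumQ.Zq] QuantumQ.ExAlg r)
      (Ψ : QuantumQ.ExAlg r ≃ₐ[QuantumQ.Zq] QuantumQ.CurQuot r)
      (Φ : QuantumQ.Loc QuantumQ.Zq (QuantumQ.MAlg.fam r) ≃ₐ[QuantumQ.Zq]
        QuantumQ.Loc QuantumQ.Zq (QuantumQ.ExAlg.fam r))
      (Φ' : QuantumQ.Loc QuantumQ.Zq (QuantumQ.MAlg.fam r) ≃ₐ[QuantumQ.Zq]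
        QuantumQ.Loc QuantumQ.Zq (QuantumQ.CurQuot.fam r)),
      Function.Surjective π ∧
      (∀ n : ℤ, π (QuantumQ.MAlg.M r 1 n) = QuantumQ.ExAlg.m r n) ∧
      (∀ (α : ℕ) (n : ℤ), α ≤ r + 2 →
        π (QuantumQ.MAlg.M r α n) = QuantumQ.qDet (QuantumQ.ExAlg.m r) α n) ∧
      (∀ n : ℤ, Ψ (QuantumQ.ExAlg.m r n) = QuantumQ.CurQuot.e r n) ∧
      (∀ x : QuantumQ.MAlg r,
        Φ (QuantumQ.Loc.of QuantumQ.Zq (QuantumQ.MAlg.fam r) x) =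
          QuantumQ.Loc.of QuantumQ.Zq (QuantumQ.ExAlg.fam r) (π x)) ∧
      (∀ x : QuantumQ.MAlg r,
        Φ' (QuantumQ.Loc.of QuantumQ.Zq (QuantumQ.MAlg.fam r) x) =
          QuantumQ.Loc.of QuantumQ.Zq (QuantumQ.CurQuot.fam r) (Ψ (π x))) := by
  obtain ⟨Φ, hΦ⟩ := QuantumQ.exists_loc_equiv hr
  obtain ⟨Θ, hΘ⟩ := QuantumQ.exists_loc_exAlgEquiv (r := r)
  exact ⟨QuantumQ.MAlg.toExAlg r, QuantumQ.exAlgEquiv r, Φ, Φ.trans Θ,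
    QuantumQ.MAlg.toExAlg_surjective, QuantumQ.MAlg.toExAlg_M_one,
    fun α n hα => QuantumQ.MAlg.toExAlg_M α hα n, QuantumQ.exAlgEquiv_m, hΦ,
    fun x => (congrArg Θ (hΦ x)).trans (hΘ _)⟩
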